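/- **Setting.** Let $R$ be a commutative noetherian ring in which linear equations are solvable (one can decide whether $b\in\langle c_1,\dots,c_k\rangle_R$ and, if so, find $a_i$ with $b=\sum a_ic_i$, and find finite generating sets of syzygy modules; the procedure below uses this only to carry out its ideal membership tests and the step $\mathrm{Div}_R$). Let $R[[t]][x]=R[[t_1,\dots,t_m]][x_1,\dots,x_n]$ and let $R[[t]][x]^s$ be the free module with basis $e_1,\dots,e_s$. A *monomial ordering* $>$ on the monomials $t^\beta x^\alpha e_i$ is a strict total order with $a>b\Rightarrow qa>qb$ for all $q=t^\beta x^\alpha$, which restricts to the same ordering of the monomials $t^\beta x^\alpha$ in each component. It is *$t$-local* if $e_i>t^\beta e_i$ for all $i$ and all $\beta\neq0$. It is *weighted* if there are $w\in\mathbb R_{<0}^m\times\mathbb R^n\times\mathbb R^s$ and a $t$-local monomial ordering $>'$ (the tiebreaker) such that $t^\beta x^\alpha e_i>t^\delta x^\gamma e_j$ iff $w\cdot(\beta,\alpha,e_i)>w\cdot(\delta,\gamma,e_j)$, or these are equal and $t^\beta x^\alpha e_i>'t^\delta x^\gamma e_j$; a weighted ordering is $t$-local. Write $\mathrm{lm},\mathrm{lc},\mathrm{lt}$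 for the leading monomial, coefficient and term with respect to $>$, with $\mathrm{lt}(0)=0$ and $\mathrm{lm}(0)$ smaller than every monomial; $0$ has no leading monomial for the purpose of divisibility. $\langle\cdot\rangle$ is the generated $R[[t]][x]$-submodule. Put $\deg_x f=\max|\alpha|$ over the monomials $t^\beta x^\alpha e_i$ of $f$, and $\mathrm{ecart}(f)=\deg_x f-\deg_x\mathrm{lm}(f)$ for $f\ne0$. With a new variable $x_0$ and $x_h=(x_0,\dots,x_n)$, let $f^h\in R[[t]][x_h]^s$ be obtained from $f$ by multiplying each monomial $t^\beta x^\alpha e_i$ by $x_0^{\deg_xf-|\alpha|}$, let $F^d=F|_{x_0=1}$, and let $a>_hb$ iff $\deg_{x_h}a>\deg_{x_h}b$, or the degrees agree and $a|_{x_0=1}>b|_{x_0=1}$. **Homogeneous division** $\mathrm{HDDwR}(f,(g_1,\dots,g_k),>)$. Start with $f_0=f$. As long as $f_\nu\ne0$: if $\mathrm{lt}(f_\nu)\in\langle\mathrm{lt}(g_1),\dots,\mathrm{lt}(g_k)\rangle$, let $D_\nu=\{i:\mathrm{lm}(g_i)\mid\mathrm{lm}(f_\nu)\}$, use $\mathrm{Div}_R$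 to choose $a_i\in R$ ($i\in D_\nu$) with $\mathrm{lc}(f_\nu)=\sum_{i\in D_\nu}a_i\,\mathrm{lc}(g_i)$ and $a_i\mathrm{lc}(g_i)\notin\langle\mathrm{lc}(g_j): j\in D_\nu,\,j<i\rangle$ unless $a_i\mathrm{lc}(g_i)=0$, and set $q_{i,\nu}=a_i\,\mathrm{lm}(f_\nu)/\mathrm{lm}(g_i)$ for $i\in D_\nu$, $q_{i,\nu}=0$ for $i\notin D_\nu$, $r_\nu=0$; otherwise set all $q_{i,\nu}=0$ and $r_\nu=\mathrm{lt}(f_\nu)$. Then $f_{\nu+1}=f_\nu-\sum_iq_{i,\nu}g_i-r_\nu$. The output is $q_i=\sum_\nu q_{i,\nu}$, $r=\sum_\nu r_\nu$ (sums in the $\langle t\rangle$-adic topology). **Weak division** $\mathrm{DwR}(f,(g_1,\dots,g_k),>)$. 1. If $f=0$ or $\mathrm{lt}(f)\notin\langle\mathrm{lt}(g_1),\dots,\mathrm{lt}(g_k)\rangle$, return $(u,(q_i),r)=(1,(0,\dots,0),f)$. 2. Otherwise let $D=\{i:\mathrm{lm}(g_i)\mid\mathrm{lm}(f)\}$, $D'=\emptyset$;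 while $\mathrm{lt}(f)\notin\langle\mathrm{lt}(g_i):i\in D'\rangle$, move some $i\in D$ with $\mathrm{ecart}(g_i)$ minimal from $D$ to $D'$. Let $e=\max\{\mathrm{ecart}(g_i):i\in D'\}-\mathrm{ecart}(f)$. 3. If $e>0$: compute $((Q_i'),R')=\mathrm{HDDwR}(x_0^ef^h,(\mathrm{lt}_{>_h}(g_1^h),\dots,\mathrm{lt}_{>_h}(g_k^h)),>_h)$, put $f'=(x_0^ef^h-\sum_iQ_i'g_i^h)^d$, call $(u'',(q_1'',\dots,q_{k+1}''),r)=\mathrm{DwR}(f',(g_1,\dots,g_k,f),>)$, and return $u=u''-q_{k+1}''$, $q_i=q_i''+u''\,Q_i'^d$, $r$. 4. If $e\le0$: compute $((Q_i'),R')=\mathrm{HDDwR}(f^h,(g_1^h,\dots,g_k^h),>_h)$, call $(u,(q_1'',\dots,q_k''),r)=\mathrm{DwR}(R'^d,(g_1,\dots,g_k),>)$, and return $u$, $q_i=q_i''+u\,Q_i'^d$, $r$. **Theorem.** Let $>$ be a weighted $t$-local monomial ordering and let $f,g_1,\dots,g_k\in R[[t]][x]^s$. Whatever choices are made in $\mathrm{Div}_R$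 and in step 2: - $\mathrm{DwR}(f,(g_1,\dots,g_k),>)$ makes only finitely many recursive calls: there is no infinite chain of them; - the procedure never gets stuck: at every input that is reached, either step 1 returns, or a recursive call can be made; and it has an output; - each output $(u,(q_1,\dots,q_k),r)$, with $u,q_i\in R[[t]][x]$ and $r\in R[[t]][x]^s$, is a weak division with remainder of $f$: $\mathrm{lt}(u)=1$, $$u\cdot f=q_1g_1+\dots+q_kg_k+r,$$ (ID1) $\mathrm{lm}(f)\ge\mathrm{lm}(q_ig_i)$ for all $i$, and (ID2) $\mathrm{lt}(r)\notin\langle\mathrm{lt}(g_1),\dots,\mathrm{lt}(g_k)\rangle$ unless $r=0$. In particular, every $f$ has a weak division with remainder with respect to $(g_1,\dots,g_k)$. -/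

import Mathlib

noncomputable section

namespace MixedDivision

/-! ### Mixed power series and polynomial rings, monomials -/

/-- `R⟦t₁,…,tₘ⟧[x₁,…,xₙ]`. -/
abbrev MixedRing (R : Type*) [CommRing R] (m n : ℕ) : Type _ :=
  MvPolynomial (Fin n) (MvPowerSeries (Fin m) R)

/-- The free module `R⟦t⟧[x]^s`. -/
abbrev MixedModule (R : Type*) [CommRing R] (m n s : ℕ) : Type _ :=
  Fin s → MixedRing R m n

/-- The monomial `t^β x^α` is the pair `(β, α)`; the product of monomials is the sum of pairs. -/
abbrev Mon (m n : ℕ) : Type := (Fin m →₀ ℕ) × (Fin n →₀ ℕ)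

/-- The module monomial `t^β x^α · e_i` is `((β, α), i)`. -/
abbrev ModMon (m n s : ℕ) : Type := Mon m n × Fin s

/-- A monomial ordering `>` on `Mon^s(t,x)`. -/
structure MonomialOrdering (m n s : ℕ) where
  /-- `gt a b` means `a > b`. -/
  gt : ModMon m n s → ModMon m n s → Prop
  irrefl : ∀ a, ¬ gt a a
  trans : ∀ a b c, gt a b → gt b c → gt a c
  total : ∀ a b, a ≠ b → gt a b ∨ gt b a
  mul_gt_mul : ∀ (a b : ModMon m n s) (q : Mon m n),
    gt a b → gt (q + a.1, a.2) (q + b.1, b.2)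
  component : ∀ (a b : Mon m n) (i j : Fin s), gt (a, i) (b, i) ↔ gt (a, j) (b, j)

/-- The weighted degree `w · (β, α, e_i)` of a module monomial, for `w = (wt, wx, we)`. -/
def weightedDegree {m n s : ℕ} (wt : Fin m → ℝ) (wx : Fin n → ℝ) (we : Fin s → ℝ)
    (a : ModMon m n s) : ℝ :=
  (∑ j, wt j * (a.1.1 j : ℝ)) + (∑ j, wx j * (a.1.2 j : ℝ)) + we a.2

namespace MonomialOrdering

/-- `1 · e_i > t^β · e_i` for all `β ≠ 0` and all `i`. -/
def IsTLocal {m n s : ℕ} (ord : MonomialOrdering m n s) : Prop :=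
  ∀ (β : Fin m →₀ ℕ) (i : Fin s), β ≠ 0 → ord.gt ((0, 0), i) ((β, 0), i)

/-- `ord` is the weighted ordering `>_w` for some weight vector `w ∈ ℝ_{<0}^m × ℝ^n × ℝ^s` and
some `t`-local tiebreaker `>`. (Such an ordering is itself `t`-local.) -/
def IsWeighted {m n s : ℕ} (ord : MonomialOrdering m n s) : Prop :=
  ∃ (wt : Fin m → ℝ) (wx : Fin n → ℝ) (we : Fin s → ℝ) (tie : MonomialOrdering m n s),
    (∀ j, wt j < 0) ∧ tie.IsTLocal ∧
      ∀ a b, ord.gt a b ↔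
        weightedDegree wt wx we a > weightedDegree wt wx we b ∨
          (weightedDegree wt wx we a = weightedDegree wt wx we b ∧ tie.gt a b)

/-- The ordering induced on `Mon(t,x)`; by `component` it is the same in each component. -/
def ringGt {m n s : ℕ} (ord : MonomialOrdering m n s) (a b : Mon m n) : Prop :=
  ∃ i : Fin s, ord.gt (a, i) (b, i)

end MonomialOrdering

/-! ### Leading monomials and leading terms -/

/-- The greatest element of `S` with respect to the strict ordering `gt`,
and `none` if there is no greatest element. -/
def greatest {M : Type*} (gt : M → M → Prop) (S : Set M) : Option M :=
  open Classical in
  if h : ∃ a ∈ S, ∀ b ∈ S, b ≠ a → gt a b then some h.choose else none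

section Leading

variable {R : Type*} [CommRing R] {m n s : ℕ}

/-- The coefficient of `t^β x^α`. -/
def ringCoeff (u : MixedRing R m n) (a : Mon m n) : R :=
  MvPowerSeries.coeff a.1 (MvPolynomial.coeff a.2 u)

/-- The coefficient of `t^β x^α · e_i`. -/
def modCoeff (f : MixedModule R m n s) (a : ModMon m n s) : R := ringCoeff (f a.2) a.1

/-- The term `c · t^β x^α`. -/
def ringTerm (a : Mon m n) (c : R) : MixedRing R m n :=
  MvPolynomial.monomial a.2 (MvPowerSeries.monomial a.1 c)

/-- The term `c · t^β x^α · e_i`. -/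
def modTerm (a : ModMon m n s) (c : R) : MixedModule R m n s :=
  Pi.single a.2 (ringTerm a.1 c)

namespace MonomialOrdering

variable (ord : MonomialOrdering m n s)

/-- The leading monomial of an element of `R⟦t⟧[x]^s`; it is `none` for the zero element. -/
def lm (f : MixedModule R m n s) : Option (ModMon m n s) :=
  greatest ord.gt {a | modCoeff f a ≠ 0}

/-- The leading term of an element of `R⟦t⟧[x]^s`; it is `0` for the zero element. -/
def lt (f : MixedModule R m n s) : MixedModule R m n s :=
  match ord.lm f with
  | none => 0
  | some a => modTerm a (modCoeff f a)

/-- The leading coefficient of an element of `R⟦t⟧[x]^s`; it is `0` for the zero element. -/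
def lc (f : MixedModule R m n s) : R :=
  match ord.lm f with
  | none => 0
  | some a => modCoeff f a

/-- The leading term of an element of `R⟦t⟧[x]`; it is `0` for the zero element. -/
def ringLt (u : MixedRing R m n) : MixedRing R m n :=
  match greatest ord.ringGt {a | ringCoeff u a ≠ 0} with
  | none => 0
  | some a => ringTerm a (ringCoeff u a)

/-- `lm(f) ≥ lm(h)`, where the leading monomial of `0` is smaller than every monomial. -/
def LmGe (f h : MixedModule R m n s) : Prop :=
  ∀ b ∈ ord.lm h, ∃ a ∈ ord.lm f, a = b ∨ ord.gt a b

/-- `lm(g)` and `lm(f)` exist and `lm(g)` divides `lm(f)`. -/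
def LmDvd (g f : MixedModule R m n s) : Prop :=
  ∃ b ∈ ord.lm g, ∃ a ∈ ord.lm f, b.2 = a.2 ∧ b.1 ≤ a.1

/-- The module `⟨lt(g_i) ∣ i ∈ D⟩`. -/
def ltSpan {k : ℕ} (g : Fin k → MixedModule R m n s) (D : Set (Fin k)) :
    Submodule (MixedRing R m n) (MixedModule R m n s) :=
  Submodule.span (MixedRing R m n) ((fun i => ord.lt (g i)) '' D)

end MonomialOrdering

end Leading

/-! ### Homogenization, dehomogenization and ecart -/

section Homogenization

variable {R : Type*} [CommRing R] {m n s : ℕ}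

/-- The `x`-degree `max |α|` over the monomials `t^β x^α · e_i` of `f` (`0` for `f = 0`). -/
def degX (f : MixedModule R m n s) : ℕ :=
  Finset.univ.sup fun i => (f i).totalDegree

/-- The homogenization `f^h ∈ R⟦t⟧[x₀,x₁,…,xₙ]^s`; the new variable `x₀` has index `0`. -/
def homogenization (f : MixedModule R m n s) : MixedModule R m (n + 1) s := fun i =>
  ∑ α ∈ (f i).support,
    MvPolynomial.monomial (Finsupp.cons (degX f - α.degree) α) (MvPolynomial.coeff α (f i))

/-- The substitution `x₀ = 1` on `R⟦t⟧[x₀,x₁,…,xₙ]`. -/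
def ringDehomogenization : MixedRing R m (n + 1) →ₐ[MvPowerSeries (Fin m) R] MixedRing R m n :=
  MvPolynomial.aeval (Fin.cons 1 MvPolynomial.X)

/-- The dehomogenization `F^d = F|_{x₀ = 1}`. -/
def dehomogenization (F : MixedModule R m (n + 1) s) : MixedModule R m n s :=
  fun i => ringDehomogenization (F i)

/-- The monomial `a|_{x₀ = 1}`. -/
def monDehomogenization (a : ModMon m (n + 1) s) : ModMon m n s :=
  ((a.1.1, a.1.2.tail), a.2)

theorem monDehomogenization_inj {a b : ModMon m (n + 1) s}
    (hd : a.1.2.degree = b.1.2.degree)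
    (h : monDehomogenization a = monDehomogenization b) : a = b := by
  obtain ⟨⟨β, α⟩, i⟩ := a
  obtain ⟨⟨δ, γ⟩, j⟩ := b
  simp only [monDehomogenization, Prod.mk.injEq] at h hd ⊢
  obtain ⟨⟨h1, h2⟩, h3⟩ := h
  refine ⟨⟨h1, ?_⟩, h3⟩
  have h4 : ∀ j : Fin n, α j.succ = γ j.succ := fun j => by
    simpa [Finsupp.tail_apply] using DFunLike.congr_fun h2 j
  have h0 : α 0 = γ 0 := by
    simp only [Finsupp.degree_eq_sum, Fin.sum_univ_succ, h4] at hd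
    omega
  ext j
  refine Fin.cases h0 h4 j

/-- The ordering `>_h` on `Mon^s(t,x₀,x)`: compare the `x_h`-degrees first, then apply `>` after
setting `x₀ = 1`. -/
def MonomialOrdering.homogenized (ord : MonomialOrdering m n s) :
    MonomialOrdering m (n + 1) s where
  gt a b := a.1.2.degree > b.1.2.degree ∨
    (a.1.2.degree = b.1.2.degree ∧ ord.gt (monDehomogenization a) (monDehomogenization b))
  irrefl a h := by
    rcases h with h | h
    · exact lt_irrefl _ h
    · exact ord.irrefl _ h.2
  trans a b c hab hbc := by
    rcases hab with h | ⟨h, h'⟩ <;> rcases hbc with k | ⟨k, k'⟩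
    · exact Or.inl (by omega)
    · exact Or.inl (by omega)
    · exact Or.inl (by omega)
    · exact Or.inr ⟨h.trans k, ord.trans _ _ _ h' k'⟩
  total a b hab := by
    rcases lt_trichotomy a.1.2.degree b.1.2.degree with h | h | h
    · exact Or.inr (Or.inl h)
    · rcases ord.total _ _ (fun e => hab (monDehomogenization_inj h e)) with k | k
      · exact Or.inl (Or.inr ⟨h, k⟩)
      · exact Or.inr (Or.inr ⟨h.symm, k⟩)
    · exact Or.inl (Or.inl h)
  mul_gt_mul a b q h := by
    have key : ∀ c : ModMon m (n + 1) s, monDehomogenization (q + c.1, c.2) =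
        ((q.1, q.2.tail) + (monDehomogenization c).1, (monDehomogenization c).2) := by
      intro c
      simp only [monDehomogenization, Prod.mk.injEq, Prod.fst_add, Prod.snd_add, Prod.mk_add_mk,
        and_true, true_and]
      ext j
      simp [Finsupp.tail_apply]
    rcases h with h | ⟨h, h'⟩
    · left
      simp only [Prod.snd_add, map_add]
      omega
    · right
      refine ⟨by simp only [Prod.snd_add, map_add]; omega, ?_⟩
      rw [key, key]
      exact ord.mul_gt_mul _ _ _ h'
  component a b i j := by
    simp only [monDehomogenization]
    rw [ord.component (a.1, a.2.tail) (b.1, b.2.tail) i j]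

/-- `ecart(f) = deg_x(f) - deg_x(lm(f))` (`0` for `f = 0`). -/
def MonomialOrdering.ecart (ord : MonomialOrdering m n s) (f : MixedModule R m n s) : ℕ :=
  match ord.lm f with
  | none => 0
  | some a => degX f - a.1.2.degree

end Homogenization

/-! ### Homogeneous determinate division with remainder -/

section HDDwR

variable {R : Type*} [CommRing R] {m n s : ℕ}

/-- `a` is an admissible output of the division `Div_R(b, (c_i)_{i ∈ D})` in the ground ring:
`b = ∑_{i ∈ D} a_i c_i`, and `a_i c_i ∉ ⟨c_j ∣ j ∈ D, j < i⟩` unless `a_i c_i = 0`. -/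
def IsGroundDivision {k : ℕ} (b : R) (D : Finset (Fin k)) (c a : Fin k → R) : Prop :=
  b = ∑ i ∈ D, a i * c i ∧
    ∀ i ∈ D, a i * c i ≠ 0 → a i * c i ∉ Ideal.span (c '' {j | j ∈ D ∧ j < i})

open Classical in
/-- One pass through the loop of the homogeneous division, from the current element `f` to the
next element `f'`, with the terms `q i` and `r` that are added to the quotients and to the
remainder. When the current element is `0`, the loop has ended and nothing changes any more. -/
def HDDwRStep (ord : MonomialOrdering m n s) {k : ℕ} (g : Fin k → MixedModule R m n s)
    (f : MixedModule R m n s) (q : Fin k → MixedRing R m n) (r f' : MixedModule R m n s) :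
    Prop :=
  (f = 0 ∧ q = 0 ∧ r = 0 ∧ f' = 0) ∨
  (f ≠ 0 ∧ f' = f - (∑ i, q i • g i + r) ∧
    ((ord.lt f ∈ ord.ltSpan g Set.univ ∧ r = 0 ∧
        ∃ a : Fin k → R,
          IsGroundDivision (ord.lc f) {i | ord.LmDvd (g i) f} (fun i => ord.lc (g i)) a ∧
          ∀ i, (ord.LmDvd (g i) f → ∀ d ∈ ord.lm f, ∀ b ∈ ord.lm (g i),
                  q i = ringTerm (d.1 - b.1) (a i)) ∧
               (¬ ord.LmDvd (g i) f → q i = 0)) ∨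
      (ord.lt f ∉ ord.ltSpan g Set.univ ∧ q = 0 ∧ r = ord.lt f)))

/-- The ideal `⟨t₁,…,tₘ⟩` of `R⟦t⟧[x]`. -/
def tIdeal (R : Type*) [CommRing R] (m n : ℕ) : Ideal (MixedRing R m n) :=
  Ideal.span (Set.range fun j : Fin m => MvPolynomial.C (MvPowerSeries.X j))

/-- `∑_ν p_ν = P` in the `⟨t⟩`-adic topology of `R⟦t⟧[x]`. -/
def HasTAdicSum (p : ℕ → MixedRing R m n) (P : MixedRing R m n) : Prop :=
  ∀ N : ℕ, ∃ M : ℕ, ∀ K ≥ M, P - ∑ ν ∈ Finset.range K, p ν ∈ tIdeal R m n ^ N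

/-- `(Q, r)` is an output of the (possibly infinite, `⟨t⟩`-adically convergent) homogeneous
determinate division with remainder of `f` by `g₁,…,g_k`. -/
def HDDwR (ord : MonomialOrdering m n s) {k : ℕ} (f : MixedModule R m n s)
    (g : Fin k → MixedModule R m n s) (Q : Fin k → MixedRing R m n)
    (r : MixedModule R m n s) : Prop :=
  ∃ (F : ℕ → MixedModule R m n s) (q : ℕ → Fin k → MixedRing R m n)
    (ρ : ℕ → MixedModule R m n s),
    F 0 = f ∧ (∀ ν, HDDwRStep ord g (F ν) (q ν) (ρ ν) (F (ν + 1))) ∧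
    (∀ i, HasTAdicSum (fun ν => q ν i) (Q i)) ∧
    ∀ j, HasTAdicSum (fun ν => ρ ν j) (r j)

end HDDwR

/-! ### The recursive procedure for weak division with remainder -/

section DwR

variable {R : Type*} [CommRing R] {m n s : ℕ}

/-- The selection loop: from the current index sets `D` and `D'`, as long as
`lt(f) ∉ ⟨lt(g_i) ∣ i ∈ D'⟩`, move an index of minimal ecart from `D` to `D'`; the last argument
is the final value of `D'`. -/
inductive Selection (ord : MonomialOrdering m n s) {k : ℕ} (f : MixedModule R m n s)
    (g : Fin k → MixedModule R m n s) :
    Finset (Fin k) → Finset (Fin k) → Finset (Fin k) → Prop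
  | done (D D' : Finset (Fin k)) (h : ord.lt f ∈ ord.ltSpan g (D' : Set (Fin k))) :
      Selection ord f g D D' D'
  | pick (D D' E : Finset (Fin k)) (i : Fin k)
      (h : ord.lt f ∉ ord.ltSpan g (D' : Set (Fin k))) (hi : i ∈ D)
      (hmin : ∀ j ∈ D, ord.ecart (g i) ≤ ord.ecart (g j))
      (hrec : Selection ord f g (D.erase i) (insert i D') E) :
      Selection ord f g D D' E

/-- `f ≠ 0` and `lt(f) ∈ ⟨lt(g₁),…,lt(g_k)⟩`. -/
def Reducible (ord : MonomialOrdering m n s) {k : ℕ} (f : MixedModule R m n s)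
    (g : Fin k → MixedModule R m n s) : Prop :=
  f ≠ 0 ∧ ord.lt f ∈ ord.ltSpan g Set.univ

open Classical in
/-- In the reducible case, `max {ecart(g_i) ∣ i ∈ D'} = c` for a result `D'` of the selection loop
started with `D = {i ∣ lm(g_i) divides lm(f)}` and `D' = ∅`. -/
def SelectedEcart (ord : MonomialOrdering m n s) {k : ℕ} (f : MixedModule R m n s)
    (g : Fin k → MixedModule R m n s) (c : ℕ) : Prop :=
  ∃ D' : Finset (Fin k), Selection ord f g {i | ord.LmDvd (g i) f} ∅ D' ∧
    c = D'.sup fun i => ord.ecart (g i)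

/-- The case `e > 0`: `Q` are the quotients of the division of `x₀^e f^h` by the
`lt(g_i^h)`, and `f' = (x₀^e f^h - ∑ Q_i g_i^h)^d`. -/
def EcartStep (ord : MonomialOrdering m n s) {k : ℕ} (f : MixedModule R m n s)
    (g : Fin k → MixedModule R m n s) (Q : Fin k → MixedRing R m (n + 1))
    (f' : MixedModule R m n s) : Prop :=
  Reducible ord f g ∧ ∃ c e : ℕ, SelectedEcart ord f g c ∧ ord.ecart f < c ∧ e = c - ord.ecart f ∧
    (∃ R' : MixedModule R m (n + 1) s,
      HDDwR ord.homogenized ((MvPolynomial.X 0 : MixedRing R m (n + 1)) ^ e • homogenization f)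
        (fun i => ord.homogenized.lt (homogenization (g i))) Q R') ∧
    f' = dehomogenization ((MvPolynomial.X 0 : MixedRing R m (n + 1)) ^ e • homogenization f -
      ∑ i, Q i • homogenization (g i))

/-- The case `e ≤ 0`: `Q` and `R'` are the quotients and the remainder of the division of `f^h` by
the `g_i^h`, and `f' = R'^d`. -/
def DirectStep (ord : MonomialOrdering m n s) {k : ℕ} (f : MixedModule R m n s)
    (g : Fin k → MixedModule R m n s) (Q : Fin k → MixedRing R m (n + 1))
    (f' : MixedModule R m n s) : Prop :=
  Reducible ord f g ∧ ∃ c : ℕ, SelectedEcart ord f g c ∧ c ≤ ord.ecart f ∧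
    ∃ R' : MixedModule R m (n + 1) s,
      HDDwR ord.homogenized (homogenization f) (fun i => homogenization (g i)) Q R' ∧
      f' = dehomogenization R'

/-- `DwR ord f g u q r`: a run of the recursive procedure on the input `(f, (g₁,…,g_k))` returns
`(u, (q₁,…,q_k), r)`. -/
inductive DwR (ord : MonomialOrdering m n s) :
    {k : ℕ} → (f : MixedModule R m n s) → (g : Fin k → MixedModule R m n s) →
      (u : MixedRing R m n) → (q : Fin k → MixedRing R m n) → (r : MixedModule R m n s) → Prop
  | done {k : ℕ} (f : MixedModule R m n s) (g : Fin k → MixedModule R m n s)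
      (h : ¬ Reducible ord f g) : DwR ord f g 1 0 f
  | ecart {k : ℕ} (f f' r : MixedModule R m n s) (g : Fin k → MixedModule R m n s)
      (Q : Fin k → MixedRing R m (n + 1)) (u : MixedRing R m n)
      (q : Fin (k + 1) → MixedRing R m n)
      (hstep : EcartStep ord f g Q f')
      (hrec : DwR ord f' (Fin.snoc g f : Fin (k + 1) → MixedModule R m n s) u q r) :
      DwR ord f g (u - q (Fin.last k))
        (fun i => q i.castSucc + u * ringDehomogenization (Q i)) r
  | direct {k : ℕ} (f f' r : MixedModule R m n s) (g : Fin k → MixedModule R m n s)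
      (Q : Fin k → MixedRing R m (n + 1)) (u : MixedRing R m n) (q : Fin k → MixedRing R m n)
      (hstep : DirectStep ord f g Q f') (hrec : DwR ord f' g u q r) :
      DwR ord f g u (fun i => q i + u * ringDehomogenization (Q i)) r

/-- An input `(f, (g₁,…,g_k))` of the procedure. -/
structure Input (R : Type*) [CommRing R] (m n s : ℕ) where
  k : ℕ
  f : MixedModule R m n s
  g : Fin k → MixedModule R m n s

/-- Processing the first input may lead to a recursive call with the second input. -/
inductive RecursiveCall (ord : MonomialOrdering m n s) : Input R m n s → Input R m n s → Prop
  | ecart {k : ℕ} (f f' : MixedModule R m n s) (g : Fin k → MixedModule R m n s)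
      (Q : Fin k → MixedRing R m (n + 1)) (hstep : EcartStep ord f g Q f') :
      RecursiveCall ord ⟨k, f, g⟩ ⟨k + 1, f', Fin.snoc g f⟩
  | direct {k : ℕ} (f f' : MixedModule R m n s) (g : Fin k → MixedModule R m n s)
      (Q : Fin k → MixedRing R m (n + 1)) (hstep : DirectStep ord f g Q f') :
      RecursiveCall ord ⟨k, f, g⟩ ⟨k, f', g⟩

/-- `u f = q₁ g₁ + ⋯ + q_k g_k + r` is a weak division with remainder of `f`. -/
structure IsWeakDivision (ord : MonomialOrdering m n s) {k : ℕ} (f : MixedModule R m n s)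
    (g : Fin k → MixedModule R m n s) (u : MixedRing R m n) (q : Fin k → MixedRing R m n)
    (r : MixedModule R m n s) : Prop where
  lt_unit : ord.ringLt u = 1
  eq : u • f = ∑ i, q i • g i + r
  /-- (ID1) -/
  id1 : ∀ i, ord.LmGe f (q i • g i)
  /-- (ID2) -/
  id2 : r ≠ 0 → ord.lt r ∉ ord.ltSpan g Set.univ

end DwR

end MixedDivision

end

/-!
# Weak division with remainder in `R⟦t⟧[x]^s`

Everything is reduced to statements about coefficients and monomials. A term lies in a module
generated by terms if and only if its coefficient lies in the ideal of the coefficients of those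
generators whose monomials divide its monomial (`modTerm_mem_ltSpan_iff`).

*Homogeneous division.* Since the weights of the `t_j` are negative, only finitely many monomials of
a fixed `x_h`-degree lie above a given one (`IsWeighted.upFinite_homogenized`). The leading
monomials strictly decrease during the homogeneous division, so every monomial disappears after
finitely many steps; this gives `⟨t⟩`-adic convergence (`exists_HDDwR`). In the limit
`f = ∑ Q_i g_i + r`, each monomial of `Q_i` times `lm(g_i)` is the leading monomial of an
intermediate element, and no term of `r` lies in `⟨lt(g_i)⟩` (`HDDwR.eq`, `HDDwR.quotient`,
`HDDwR.remainder`).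

*Termination.* The exponent of `x₀` in `lm(g^h)` is `ecart(g)`, so `lt(f^h) ∈ ⟨lt(g_i^h)⟩` means that
`lt(f)` can be reduced by elements `g_i` with `ecart(g_i) ≤ ecart(f)`; say then that `f` is directly
reducible (`lt_mem_ltSpan_homogenized`, `ecartIdeal`). The selection loop prefers small ecarts, so
a call with `e > 0` happens only if `f` is not directly reducible, and `f` then joins the list. A
call with `e ≤ 0` happens only if `f` is directly reducible and leads to an element that is not
(`RecursiveCall.cases_lc`). Hence an infinite chain would contain infinitely many calls with `e > 0`,
and the terms `lt(f^h)` of these would generate a strictly increasing chain of modules. This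
contradicts Dickson's lemma together with the noetherianity of `R`
(`exists_mem_span_of_wellQuasiOrdered`).

*Correctness.* (ID1) has to be strengthened for the induction: every monomial of `q_i` times
`lm(g_i)` is at most `lm(f)` (`IsStrongDivision`). If `R` has zero divisors, this is more than a
bound for `lm(q_i g_i)`, and it is needed to see that `u'' - q''_{k+1}` has leading term `1`: in a
call with `e > 0` the leading term of `x₀^e f^h` is cancelled, hence `lm(f') < lm(f)`
(`EcartStep.gt_of_ne_zero`), and each monomial of `q''_{k+1}` is smaller than `1`.
-/

noncomputable section

namespace MixedDivision

/-! ### Coefficients -/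

section Coefficients

variable {R : Type*} [CommRing R] {m n s : ℕ}

theorem ringExt {p q : MixedRing R m n} (h : ∀ a, ringCoeff p a = ringCoeff q a) : p = q :=
  MvPolynomial.ext _ _ fun α => MvPowerSeries.ext fun β => h (β, α)

theorem modExt {f g : MixedModule R m n s} (h : ∀ a, modCoeff f a = modCoeff g a) : f = g :=
  funext fun i => ringExt fun a => h (a, i)

@[simp] theorem ringCoeff_zero (a : Mon m n) : ringCoeff (0 : MixedRing R m n) a = 0 := by
  simp [ringCoeff]

@[simp] theorem ringCoeff_add (p q : MixedRing R m n) (a : Mon m n) :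
    ringCoeff (p + q) a = ringCoeff p a + ringCoeff q a := by
  simp [ringCoeff]

@[simp] theorem ringCoeff_sub (p q : MixedRing R m n) (a : Mon m n) :
    ringCoeff (p - q) a = ringCoeff p a - ringCoeff q a := by
  simp [ringCoeff]

@[simp] theorem ringCoeff_sum {ι : Type*} (S : Finset ι) (p : ι → MixedRing R m n) (a : Mon m n) :
    ringCoeff (∑ i ∈ S, p i) a = ∑ i ∈ S, ringCoeff (p i) a := by
  simp [ringCoeff, MvPolynomial.coeff_sum]

theorem ringCoeff_ringTerm (a b : Mon m n) (c : R) :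
    ringCoeff (ringTerm a c) b = if b = a then c else 0 := by
  classical
  obtain ⟨β, α⟩ := a
  obtain ⟨δ, γ⟩ := b
  simp only [ringCoeff, ringTerm, MvPolynomial.coeff_monomial, Prod.mk.injEq]
  by_cases h : α = γ
  · simp [h, MvPowerSeries.coeff_monomial]
  · simp [h, Ne.symm h]

theorem ringTerm_zero_one : (ringTerm 0 1 : MixedRing R m n) = 1 := by
  simp [ringTerm, MvPowerSeries.monomial_zero_one]

theorem ringCoeff_one (a : Mon m n) :
    ringCoeff (1 : MixedRing R m n) a = if a = 0 then 1 else 0 := by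
  rw [← ringTerm_zero_one, ringCoeff_ringTerm]

theorem ringCoeff_mul (p q : MixedRing R m n) (c : Mon m n) :
    ringCoeff (p * q) c = ∑ x ∈ Finset.HasAntidiagonal.antidiagonal c.2,
      ∑ y ∈ Finset.HasAntidiagonal.antidiagonal c.1,
      ringCoeff p (y.1, x.1) * ringCoeff q (y.2, x.2) := by
  classical
  simp [ringCoeff, MvPolynomial.coeff_mul, MvPowerSeries.coeff_mul]

/-- A monomial of a product is a product of monomials of the factors. -/
theorem exists_of_ringCoeff_mul_ne_zero {p q : MixedRing R m n} {c : Mon m n}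
    (h : ringCoeff (p * q) c ≠ 0) :
    ∃ a b, a + b = c ∧ ringCoeff p a ≠ 0 ∧ ringCoeff q b ≠ 0 := by
  rw [ringCoeff_mul] at h
  obtain ⟨x, hx, h⟩ := Finset.exists_ne_zero_of_sum_ne_zero h
  obtain ⟨y, hy, h⟩ := Finset.exists_ne_zero_of_sum_ne_zero h
  rw [Finset.HasAntidiagonal.mem_antidiagonal] at hx hy
  exact ⟨(y.1, x.1), (y.2, x.2), Prod.ext hy hx, left_ne_zero_of_mul h, right_ne_zero_of_mul h⟩

theorem ringCoeff_ringTerm_mul (a b : Mon m n) (c : R) (p : MixedRing R m n) :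
    ringCoeff (ringTerm a c * p) (a + b) = c * ringCoeff p b := by
  simp [ringCoeff, ringTerm, MvPolynomial.coeff_monomial_mul, MvPowerSeries.coeff_add_monomial_mul]

theorem ringTerm_mul_ringTerm (a b : Mon m n) (c d : R) :
    (ringTerm a c * ringTerm b d : MixedRing R m n) = ringTerm (a + b) (c * d) := by
  simp [ringTerm, MvPolynomial.monomial_mul, MvPowerSeries.monomial_mul_monomial]

theorem ringTerm_add (a : Mon m n) (c d : R) :
    (ringTerm a (c + d) : MixedRing R m n) = ringTerm a c + ringTerm a d := by
  simp [ringTerm]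

@[simp] theorem ringTerm_zero (a : Mon m n) : (ringTerm a 0 : MixedRing R m n) = 0 := by
  simp [ringTerm]

@[simp] theorem modCoeff_zero (a : ModMon m n s) : modCoeff (0 : MixedModule R m n s) a = 0 := by
  simp [modCoeff]

@[simp] theorem modCoeff_add (f g : MixedModule R m n s) (a : ModMon m n s) :
    modCoeff (f + g) a = modCoeff f a + modCoeff g a := by
  simp [modCoeff]

@[simp] theorem modCoeff_sub (f g : MixedModule R m n s) (a : ModMon m n s) :
    modCoeff (f - g) a = modCoeff f a - modCoeff g a := by
  simp [modCoeff]

@[simp] theorem modCoeff_sum {ι : Type*} (S : Finset ι) (f : ι → MixedModule R m n s)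
    (a : ModMon m n s) : modCoeff (∑ i ∈ S, f i) a = ∑ i ∈ S, modCoeff (f i) a := by
  simp [modCoeff, Finset.sum_apply]

theorem modCoeff_modTerm (a b : ModMon m n s) (c : R) :
    modCoeff (modTerm a c) b = if b = a then c else 0 := by
  obtain ⟨a, i⟩ := a
  obtain ⟨b, j⟩ := b
  by_cases h : j = i
  · subst h
    simp [modCoeff, modTerm, ringCoeff_ringTerm]
  · simp [modCoeff, modTerm, h]

theorem exists_modCoeff_ne_zero {f : MixedModule R m n s} (h : f ≠ 0) : ∃ a, modCoeff f a ≠ 0 := by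
  by_contra! h'
  exact h (modExt fun a => by simp [h'])

theorem exists_of_modCoeff_smul_ne_zero {p : MixedRing R m n} {f : MixedModule R m n s}
    {c : ModMon m n s} (h : modCoeff (p • f) c ≠ 0) :
    ∃ a b, a + b = c.1 ∧ ringCoeff p a ≠ 0 ∧ modCoeff f (b, c.2) ≠ 0 :=
  exists_of_ringCoeff_mul_ne_zero h

theorem modCoeff_ringTerm_smul (a b : Mon m n) (i : Fin s) (c : R) (f : MixedModule R m n s) :
    modCoeff (ringTerm a c • f) (a + b, i) = c * modCoeff f (b, i) :=
  ringCoeff_ringTerm_mul a b c (f i)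

theorem ringTerm_smul_modTerm (a : Mon m n) (b : ModMon m n s) (c d : R) :
    ringTerm a c • (modTerm b d : MixedModule R m n s) = modTerm (a + b.1, b.2) (c * d) := by
  rw [modTerm, ← Pi.single_smul', smul_eq_mul, ringTerm_mul_ringTerm]
  rfl

theorem modTerm_add (a : ModMon m n s) (c d : R) :
    (modTerm a (c + d) : MixedModule R m n s) = modTerm a c + modTerm a d := by
  simp [modTerm, ringTerm_add, Pi.single_add]

@[simp] theorem modTerm_zero (a : ModMon m n s) : (modTerm a 0 : MixedModule R m n s) = 0 := by
  simp [modTerm]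

theorem degree_le_degX_of_mem_support {f : MixedModule R m n s} {i : Fin s} {α : Fin n →₀ ℕ}
    (h : α ∈ (f i).support) : α.degree ≤ degX f :=
  (MvPolynomial.le_totalDegree h).trans
    (Finset.le_sup (f := fun i => (f i).totalDegree) (Finset.mem_univ i))

theorem degree_le_degX {f : MixedModule R m n s} {a : ModMon m n s} (ha : modCoeff f a ≠ 0) :
    a.1.2.degree ≤ degX f := by
  refine degree_le_degX_of_mem_support (i := a.2) ?_
  rw [MvPolynomial.mem_support_iff]
  intro h
  simp [modCoeff, ringCoeff, h] at ha

end Coefficients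

/-! ### The `⟨t⟩`-adic topology in terms of coefficients -/

section TAdic

variable {R : Type*} [CommRing R] {m n s : ℕ}

/-- For `f = ∑ a_β t^β`, the power series `∑ a_{β + e_j} t^β` over those `β` for which `j` is
the least index occurring in `β + e_j`. A power series `f` without constant term is `∑_j t_j f_j` for these `f_j`. -/
def firstQuotient (f : MvPowerSeries (Fin m) R) (j : Fin m) : MvPowerSeries (Fin m) R := fun β =>
  open Classical in
  if ∀ i < j, β i = 0 then MvPowerSeries.coeff (β + Finsupp.single j 1) f else 0

theorem coeff_firstQuotient (f : MvPowerSeries (Fin m) R) (j : Fin m) (β : Fin m →₀ ℕ) :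
    MvPowerSeries.coeff β (firstQuotient f j) = open Classical in
      if ∀ i < j, β i = 0 then MvPowerSeries.coeff (β + Finsupp.single j 1) f else 0 := rfl

theorem sum_X_mul_firstQuotient (f : MvPowerSeries (Fin m) R)
    (h0 : MvPowerSeries.coeff 0 f = 0) :
    ∑ j, MvPowerSeries.X j * firstQuotient f j = f := by
  classical
  ext β
  rw [map_sum]
  by_cases hβ : β = 0
  · subst hβ
    rw [h0]
    refine Finset.sum_eq_zero fun j _ => ?_
    rw [MvPowerSeries.X, MvPowerSeries.coeff_monomial_mul, if_neg]
    intro h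
    simpa using h j
  · have hne : β.support.Nonempty := Finsupp.support_nonempty_iff.2 hβ
    set j₀ := β.support.min' hne with hj₀
    have hmem : β j₀ ≠ 0 := Finsupp.mem_support_iff.1 (β.support.min'_mem hne)
    have hlt : ∀ i < j₀, β i = 0 := by
      intro i hi
      by_contra hc
      exact absurd (β.support.min'_le i (Finsupp.mem_support_iff.2 hc)) (not_le.2 hi)
    rw [Finset.sum_eq_single j₀]
    · have hle : Finsupp.single j₀ 1 ≤ β := by
        rw [Finsupp.single_le_iff]
        omega
      rw [MvPowerSeries.X, MvPowerSeries.coeff_monomial_mul, if_pos hle, one_mul,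
        coeff_firstQuotient, if_pos, tsub_add_cancel_of_le hle]
      intro i hi
      simp [hlt i hi]
    · intro j _ hj
      rw [MvPowerSeries.X, MvPowerSeries.coeff_monomial_mul]
      split_ifs with hle
      · rw [one_mul, coeff_firstQuotient, if_neg]
        intro hall
        rw [Finsupp.single_le_iff] at hle
        rcases lt_or_gt_of_ne hj with h | h
        · have := hlt j h
          omega
        · have := hall j₀ h
          rw [Finsupp.tsub_apply, Finsupp.single_eq_of_ne hj.symm] at this
          omega
      · rfl
    · simp

/-- A power series of order at least `N` lies in `⟨t₁,…,tₘ⟩^N`. -/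
theorem mem_span_X_pow {N : ℕ} (f : MvPowerSeries (Fin m) R)
    (h : ∀ β : Fin m →₀ ℕ, β.degree < N → MvPowerSeries.coeff β f = 0) :
    f ∈ Ideal.span (Set.range (MvPowerSeries.X : Fin m → MvPowerSeries (Fin m) R)) ^ N := by
  classical
  induction N generalizing f with
  | zero => simp
  | succ N ih =>
    rw [← sum_X_mul_firstQuotient f (h 0 (by simp)), pow_succ']
    refine Ideal.sum_mem _ fun j _ => Ideal.mul_mem_mul (Ideal.subset_span ⟨j, rfl⟩) (ih _ ?_)
    intro β hβ
    rw [coeff_firstQuotient]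
    split_ifs
    · refine h _ ?_
      simp only [map_add, Finsupp.degree_single]
      omega
    · rfl

theorem coeff_eq_zero_of_mem_span_X_pow {N : ℕ} {f : MvPowerSeries (Fin m) R}
    (h : f ∈ Ideal.span (Set.range (MvPowerSeries.X : Fin m → MvPowerSeries (Fin m) R)) ^ N)
    {β : Fin m →₀ ℕ} (hβ : β.degree < N) : MvPowerSeries.coeff β f = 0 := by
  classical
  induction N generalizing f β with
  | zero => omega
  | succ N ih =>
    rw [pow_succ'] at h
    refine Submodule.mul_induction_on h ?_ ?_
    · intro x hx y hy
      rw [MvPowerSeries.coeff_mul]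
      refine Finset.sum_eq_zero fun z hz => ?_
      rw [Finset.HasAntidiagonal.mem_antidiagonal] at hz
      have hdeg : z.1.degree + z.2.degree = β.degree := by rw [← map_add, hz]
      by_cases hz0 : z.1 = 0
      · have hx0 : MvPowerSeries.coeff 0 x = 0 := by
          refine Submodule.span_induction ?_ (by simp) ?_ ?_ hx
          · rintro _ ⟨j, rfl⟩
            simp
          · intro a b _ _ ha hb
            rw [map_add, ha, hb, add_zero]
          · intro a b _ hb
            rw [smul_eq_mul, MvPowerSeries.coeff_mul]
            simp [hb]
        rw [hz0, hx0, zero_mul]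
      · have : z.1.degree ≠ 0 := by rwa [Ne, Finsupp.degree_eq_zero_iff]
        rw [ih hy (by omega), mul_zero]
    · intro x y hx hy
      rw [map_add, hx, hy, add_zero]

theorem mem_tIdeal_pow_iff {N : ℕ} {p : MixedRing R m n} :
    p ∈ tIdeal R m n ^ N ↔ ∀ a : Mon m n, a.1.degree < N → ringCoeff p a = 0 := by
  have : tIdeal R m n = (Ideal.span (Set.range
      (MvPowerSeries.X : Fin m → MvPowerSeries (Fin m) R))).map
        (MvPolynomial.C : _ →+* MixedRing R m n) := by
    rw [Ideal.map_span, ← Set.range_comp]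
    rfl
  rw [this, ← Ideal.map_pow, MvPolynomial.mem_map_C_iff]
  exact ⟨fun h a ha => coeff_eq_zero_of_mem_span_X_pow (h a.2) ha,
    fun h α => mem_span_X_pow _ fun β hβ => h (β, α) hβ⟩

/-- `p ν → 0` in the `⟨t⟩`-adic topology: for each `N`, only finitely many `p ν` involve monomials
whose `t`-degree is less than `N`. -/
def TendsToZero (p : ℕ → MixedRing R m n) : Prop :=
  ∀ N : ℕ, ∃ M : ℕ, ∀ ν ≥ M, ∀ a : Mon m n, a.1.degree < N → ringCoeff (p ν) a = 0

/-- The coefficients of a `⟨t⟩`-adic sum are the eventual coefficients of the partial sums. -/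
theorem HasTAdicSum.exists_ringCoeff_eq {p : ℕ → MixedRing R m n} {P : MixedRing R m n}
    (h : HasTAdicSum p P) (a : Mon m n) :
    ∃ M : ℕ, ∀ K ≥ M, ringCoeff P a = ∑ ν ∈ Finset.range K, ringCoeff (p ν) a := by
  obtain ⟨M, hM⟩ := h (a.1.degree + 1)
  refine ⟨M, fun K hK => ?_⟩
  have := mem_tIdeal_pow_iff.1 (hM K hK) a (Nat.lt_succ_self _)
  rwa [ringCoeff_sub, sub_eq_zero, ringCoeff_sum] at this

theorem finite_setOf_degree_le (n D : ℕ) : {α : Fin n →₀ ℕ | α.degree ≤ D}.Finite := by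
  refine (Set.finite_Iic (Finsupp.equivFunOnFinite.symm fun _ => D)).subset fun α hα j => ?_
  exact (Finsupp.le_degree j α).trans hα

/-- A null sequence of bounded `x`-degree is summable. -/
theorem exists_hasTAdicSum {p : ℕ → MixedRing R m n} (hp : TendsToZero p) (D : ℕ)
    (hD : ∀ ν a, ringCoeff (p ν) a ≠ 0 → a.2.degree ≤ D) : ∃ P, HasTAdicSum p P := by
  classical
  choose M hM using hp
  let c : (Fin n →₀ ℕ) → MvPowerSeries (Fin m) R := fun α β =>
    ∑ ν ∈ Finset.range (M (β.degree + 1)), ringCoeff (p ν) (β, α)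
  have hc : ∀ α β, MvPowerSeries.coeff β (c α) =
      ∑ ν ∈ Finset.range (M (β.degree + 1)), ringCoeff (p ν) (β, α) := fun _ _ => rfl
  have hc' : ∀ α β K, M (β.degree + 1) ≤ K → MvPowerSeries.coeff β (c α) =
      ∑ ν ∈ Finset.range K, ringCoeff (p ν) (β, α) := by
    intro α β K hK
    rw [hc]
    refine Finset.sum_subset (Finset.range_subset_range.2 hK) fun ν _ hν => ?_
    rw [Finset.mem_range, not_lt] at hν
    exact hM _ ν hν _ (Nat.lt_succ_self _)
  refine ⟨∑ α ∈ (finite_setOf_degree_le n D).toFinset, MvPolynomial.monomial α (c α),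
    fun N => ⟨(Finset.range (N + 1)).sup M, fun K hK => mem_tIdeal_pow_iff.2 ?_⟩⟩
  rintro ⟨β, α⟩ hβ
  have hle : M (β.degree + 1) ≤ K := by
    refine le_trans (Finset.le_sup (f := M) ?_) hK
    simp only [Finset.mem_range] at hβ ⊢
    omega
  rw [ringCoeff_sub, sub_eq_zero, ringCoeff_sum (Finset.range K), ← hc' α β K hle, ringCoeff,
    MvPolynomial.coeff_sum]
  simp only [MvPolynomial.coeff_monomial, Finset.sum_ite_eq', Set.Finite.mem_toFinset,
    Set.mem_ofPred_eq]
  split_ifs with hα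
  · rfl
  · rw [map_zero, hc]
    refine (Finset.sum_eq_zero fun ν _ => ?_).symm
    by_contra hne
    exact hα (hD ν _ hne)

end TAdic

/-! ### Leading monomials -/

theorem greatest_eq_some_iff {M : Type*} {gt : M → M → Prop} (hasymm : ∀ a b, gt a b → ¬ gt b a)
    {S : Set M} {a : M} : greatest gt S = some a ↔ a ∈ S ∧ ∀ b ∈ S, b ≠ a → gt a b := by
  classical
  unfold greatest
  split_ifs with h
  · rw [Option.some.injEq]
    constructor
    · rintro rfl
      exact h.choose_spec
    · intro ha
      by_contra hne
      exact hasymm _ _ (h.choose_spec.2 a ha.1 (Ne.symm hne)) (ha.2 _ h.choose_spec.1 hne)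
  · simp only [false_iff]
    exact fun ha => h ⟨a, ha⟩

namespace MonomialOrdering

section Order

variable {m n s : ℕ}

/-- The reflexive closure of a monomial ordering. -/
def ge (ord : MonomialOrdering m n s) (a b : ModMon m n s) : Prop := a = b ∨ ord.gt a b

variable {ord : MonomialOrdering m n s} {a b c : ModMon m n s}

theorem ge_refl (a : ModMon m n s) : ord.ge a a := Or.inl rfl

theorem gt_asymm (h : ord.gt a b) : ¬ ord.gt b a := fun h' => ord.irrefl _ (ord.trans _ _ _ h h')

theorem gt_of_gt_of_ge (h : ord.gt a b) (h' : ord.ge b c) : ord.gt a c := by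
  rcases h' with rfl | h'
  · exact h
  · exact ord.trans _ _ _ h h'

theorem gt_of_ge_of_gt (h : ord.ge a b) (h' : ord.gt b c) : ord.gt a c := by
  rcases h with rfl | h
  · exact h'
  · exact ord.trans _ _ _ h h'

theorem ge_trans (h : ord.ge a b) (h' : ord.ge b c) : ord.ge a c := by
  rcases h with rfl | h
  · exact h'
  · exact Or.inr (gt_of_gt_of_ge h h')

theorem not_gt_of_ge (h : ord.ge a b) : ¬ ord.gt b a := fun h' =>
  ord.irrefl _ (gt_of_gt_of_ge h' h)

theorem ge_or_gt (a b : ModMon m n s) : ord.ge a b ∨ ord.gt b a := by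
  by_cases h : a = b
  · exact Or.inl (Or.inl h)
  · exact (ord.total a b h).imp Or.inr id

theorem ge_mul (q : Mon m n) (h : ord.ge a b) : ord.ge (q + a.1, a.2) (q + b.1, b.2) := by
  rcases h with rfl | h
  · exact ge_refl _
  · exact Or.inr (ord.mul_gt_mul _ _ _ h)

theorem ringGt_iff {a b : Mon m n} (i : Fin s) : ord.ringGt a b ↔ ord.gt (a, i) (b, i) :=
  ⟨fun ⟨j, hj⟩ => (ord.component a b j i).1 hj, fun h => ⟨i, h⟩⟩

theorem ringGt_asymm {a b : Mon m n} (h : ord.ringGt a b) : ¬ ord.ringGt b a := by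
  obtain ⟨i, hi⟩ := h
  rw [ringGt_iff i]
  exact gt_asymm hi

/-- Multiplication by a monomial that is at most `1` does not increase a module monomial. -/
theorem ge_add_of_ringGt {q : Mon m n} (h : q = 0 ∨ ord.ringGt 0 q) (a : ModMon m n s) :
    ord.ge a (q + a.1, a.2) := by
  rcases h with rfl | h
  · simpa using ge_refl a
  · rw [ringGt_iff a.2] at h
    have := ord.mul_gt_mul _ _ a.1 h
    rw [add_zero, add_comm] at this
    exact Or.inr this

theorem ringGt_zero_of_gt {q : Mon m n} {a : ModMon m n s} (h : ord.gt a (q + a.1, a.2)) :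
    ord.ringGt 0 q := by
  refine ⟨a.2, ?_⟩
  rcases ge_or_gt (ord := ord) (q, a.2) (0, a.2) with h' | h'
  · have := ge_mul a.1 h'
    rw [add_zero, add_comm] at this
    exact absurd h (not_gt_of_ge this)
  · exact h'

end Order

section Leading

variable {R : Type*} [CommRing R] {m n s : ℕ} {ord : MonomialOrdering m n s}
  {f : MixedModule R m n s} {a : ModMon m n s}

theorem lm_eq_some_iff :
    ord.lm f = some a ↔ modCoeff f a ≠ 0 ∧ ∀ b, modCoeff f b ≠ 0 → ord.ge a b := by
  rw [lm, greatest_eq_some_iff fun _ _ => gt_asymm]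
  refine and_congr Iff.rfl (forall₂_congr fun b _ => ?_)
  rw [ge, eq_comm, Ne, ← or_iff_not_imp_left]

theorem lc_of_lm (h : ord.lm f = some a) : ord.lc f = modCoeff f a := by
  rw [lc, h]

theorem lt_of_lm (h : ord.lm f = some a) : ord.lt f = modTerm a (modCoeff f a) := by
  rw [lt, h]

@[simp] theorem lm_zero : ord.lm (0 : MixedModule R m n s) = none := by
  rw [Option.eq_none_iff_forall_ne_some]
  intro a h
  exact (lm_eq_some_iff.1 h).1 (modCoeff_zero a)

theorem lt_eq_zero_of_lm (h : ord.lm f = none) : ord.lt f = 0 := by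
  rw [lt, h]

theorem lm_modTerm {c : R} (hc : c ≠ 0) (a : ModMon m n s) :
    ord.lm (modTerm a c : MixedModule R m n s) = some a := by
  refine lm_eq_some_iff.2 ⟨by simpa [modCoeff_modTerm] using hc, fun b hb => ?_⟩
  rw [modCoeff_modTerm] at hb
  by_cases h : b = a
  · exact Or.inl h.symm
  · simp [h] at hb

theorem lm_lt (f : MixedModule R m n s) : ord.lm (ord.lt f) = ord.lm f := by
  rcases h : ord.lm f with _ | a
  · rw [lt_eq_zero_of_lm h, lm_zero]
  · rw [lt_of_lm h, lm_modTerm (lm_eq_some_iff.1 h).1]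

theorem lt_lt (f : MixedModule R m n s) : ord.lt (ord.lt f) = ord.lt f := by
  rcases h : ord.lm f with _ | a
  · rw [lt_eq_zero_of_lm h, lt_eq_zero_of_lm lm_zero]
  · rw [lt_of_lm ((lm_lt f).trans h), lt_of_lm h, modCoeff_modTerm, if_pos rfl]

theorem modCoeff_lt_ne_zero {b : ModMon m n s} (h : modCoeff (ord.lt f) b ≠ 0) :
    ord.lm f = some b := by
  rcases h' : ord.lm f with _ | a
  · rw [lt_eq_zero_of_lm h'] at h
    simp at h
  · rw [lt_of_lm h', modCoeff_modTerm] at h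
    by_cases hb : b = a
    · rw [hb]
    · simp [hb] at h

/-- The ideal of the leading coefficients of those `g_i`, `i ∈ D`, whose leading monomials divide
the monomial `a`. -/
def lcIdeal (ord : MonomialOrdering m n s) {k : ℕ} (g : Fin k → MixedModule R m n s)
    (D : Set (Fin k)) (a : ModMon m n s) : Ideal R :=
  Ideal.span ((fun i => ord.lc (g i)) ''
    {i ∈ D | ∃ b, ord.lm (g i) = some b ∧ b.2 = a.2 ∧ b.1 ≤ a.1})

theorem lcIdeal_le_of_le {k : ℕ} (g : Fin k → MixedModule R m n s) (D : Set (Fin k))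
    {a b : Mon m n} (i : Fin s) (h : a ≤ b) : ord.lcIdeal g D (a, i) ≤ ord.lcIdeal g D (b, i) := by
  refine Ideal.span_mono (Set.image_mono ?_)
  rintro j ⟨hj, c, hc, hc2, hc1⟩
  exact ⟨hj, c, hc, hc2, hc1.trans h⟩

/-- Membership of a term in a module generated by terms can be decided on the coefficients. -/
theorem modTerm_mem_ltSpan_iff {k : ℕ} {g : Fin k → MixedModule R m n s} {D : Set (Fin k)}
    {a : ModMon m n s} {c : R} :
    (modTerm a c : MixedModule R m n s) ∈ ord.ltSpan g D ↔ c ∈ ord.lcIdeal g D a := by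
  constructor
  · intro h
    suffices H : ∀ f ∈ ord.ltSpan g D, ∀ b, modCoeff f b ∈ ord.lcIdeal g D b by
      simpa [modCoeff_modTerm] using H _ h a
    intro f hf
    refine Submodule.span_induction ?_ (by simp) ?_ ?_ hf
    · rintro _ ⟨i, hi, rfl⟩ b
      by_cases h0 : modCoeff (ord.lt (g i)) b = 0
      · simp [h0]
      · have hb := modCoeff_lt_ne_zero h0
        refine Ideal.subset_span ⟨i, ⟨hi, b, hb, rfl, le_rfl⟩, ?_⟩
        simp only [lc_of_lm hb, lt_of_lm hb, modCoeff_modTerm, if_true]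
    · intro x y _ _ hx hy b
      rw [modCoeff_add]
      exact Ideal.add_mem _ (hx b) (hy b)
    · intro p x _ hx b
      rw [modCoeff, Pi.smul_apply, smul_eq_mul, ringCoeff_mul]
      refine Ideal.sum_mem _ fun y hy => Ideal.sum_mem _ fun z hz => Ideal.mul_mem_left _ _ ?_
      rw [Finset.HasAntidiagonal.mem_antidiagonal] at hy hz
      refine lcIdeal_le_of_le g D b.2 ?_ (hx ((z.2, y.2), b.2))
      exact Prod.mk_le_mk.2 ⟨hz ▸ le_add_self, hy ▸ le_add_self⟩
  · intro h
    refine Submodule.span_induction (p := fun c _ => (modTerm a c : MixedModule R m n s) ∈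
      ord.ltSpan g D) ?_ ?_ ?_ ?_ h
    · rintro _ ⟨i, ⟨hi, b, hb, hb2, hb1⟩, rfl⟩
      have : (modTerm a (ord.lc (g i)) : MixedModule R m n s) =
          ringTerm (a.1 - b.1) (1 : R) • ord.lt (g i) := by
        rw [lt_of_lm hb, lc_of_lm hb, ringTerm_smul_modTerm, one_mul, tsub_add_cancel_of_le hb1,
          hb2]
      simp only [this]
      exact Submodule.smul_mem _ _ (Submodule.subset_span ⟨i, hi, rfl⟩)
    · simp
    · intro x y _ _ hx hy
      rw [modTerm_add]
      exact Submodule.add_mem _ hx hy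
    · intro r x _ hx
      have : (modTerm a (r • x) : MixedModule R m n s) =
          (ringTerm 0 r : MixedRing R m n) • modTerm a x := by
        rw [ringTerm_smul_modTerm, zero_add, smul_eq_mul]
      rw [this]
      exact Submodule.smul_mem _ _ hx

theorem ltSpan_mono {k : ℕ} (g : Fin k → MixedModule R m n s) {D E : Set (Fin k)} (h : D ⊆ E) :
    ord.ltSpan g D ≤ ord.ltSpan g E :=
  Submodule.span_mono (Set.image_mono h)

end Leading

/-! ### Finiteness of up-sets for weighted orderings -/

section UpFinite

variable {R : Type*} [CommRing R] {m n s : ℕ}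

/-- Within the set `S` of monomials, only finitely many are greater than a given one. -/
def UpFinite (ord : MonomialOrdering m n s) (S : Set (ModMon m n s)) : Prop :=
  ∀ a ∈ S, {b ∈ S | ord.gt b a}.Finite

theorem exists_lm {ord : MonomialOrdering m n s} {S : Set (ModMon m n s)} (hS : ord.UpFinite S)
    {f : MixedModule R m n s} (hf : ∀ a, modCoeff f a ≠ 0 → a ∈ S) (h0 : f ≠ 0) :
    ∃ a, ord.lm f = some a := by
  obtain ⟨a, ha⟩ := exists_modCoeff_ne_zero h0
  have hfin : {b | modCoeff f b ≠ 0 ∧ ord.ge b a}.Finite := by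
    refine ((hS a (hf a ha)).insert a).subset ?_
    rintro b ⟨hb, rfl | hb'⟩
    · exact Set.mem_insert _ _
    · exact Set.mem_insert_of_mem _ ⟨hf b hb, hb'⟩
  have : IsStrictOrder (ModMon m n s) ord.gt :=
    { irrefl := ord.irrefl, trans := ord.trans }
  obtain ⟨⟨b, hb, hba⟩, -, hmax⟩ := (hfin.wellFoundedOn (r := ord.gt)).has_min Set.univ
    ⟨⟨a, ha, ge_refl a⟩, trivial⟩
  refine ⟨b, lm_eq_some_iff.2 ⟨hb, fun c hc => ?_⟩⟩
  rcases ge_or_gt (ord := ord) b c with h | h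
  · exact h
  · exact absurd h (hmax ⟨c, hc, ge_trans (Or.inr h) hba⟩ trivial)

theorem finite_setOf_le_sum_mul {w : Fin m → ℝ} (hw : ∀ j, w j < 0) (c : ℝ) :
    {β : Fin m →₀ ℕ | c ≤ ∑ j, w j * (β j : ℝ)}.Finite := by
  refine (Set.finite_Iic (Finsupp.equivFunOnFinite.symm fun j => ⌊c / w j⌋₊)).subset
    fun β hβ j => ?_
  rw [Finsupp.equivFunOnFinite_symm_apply_apply]
  apply Nat.le_floor
  rw [le_div_iff_of_neg (hw j), mul_comm]
  refine le_trans hβ ?_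
  rw [← Finset.add_sum_erase _ _ (Finset.mem_univ j)]
  have : ∑ x ∈ Finset.univ.erase j, w x * (β x : ℝ) ≤ 0 :=
    Finset.sum_nonpos fun x _ => mul_nonpos_of_nonpos_of_nonneg (hw x).le (Nat.cast_nonneg _)
  linarith

/-- Because the weights of the `t_j` are negative, a lower bound for the weighted degree bounds the
exponents of the `t_j` once the `x`-degree is bounded. -/
theorem IsWeighted.upFinite {ord : MonomialOrdering m n s} (hord : ord.IsWeighted) (D : ℕ) :
    ord.UpFinite {a | a.1.2.degree ≤ D} := by
  obtain ⟨wt, wx, we, tie, hwt, -, hgt⟩ := hord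
  intro a _
  have hfin : (⋃ p ∈ ({α : Fin n →₀ ℕ | α.degree ≤ D} ×ˢ (Set.univ : Set (Fin s))),
      (fun β : Fin m →₀ ℕ => (((β, p.1), p.2) : ModMon m n s)) ''
        {β | weightedDegree wt wx we a - ∑ j, wx j * (p.1 j : ℝ) - we p.2 ≤
          ∑ j, wt j * (β j : ℝ)}).Finite :=
    ((finite_setOf_degree_le n D).prod Set.finite_univ).biUnion fun p _ =>
      (finite_setOf_le_sum_mul hwt _).image _
  refine hfin.subset ?_
  rintro ⟨⟨β, α⟩, i⟩ ⟨hD, hb⟩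
  refine Set.mem_biUnion (x := (α, i)) ⟨hD, trivial⟩ ⟨β, ?_, rfl⟩
  have hw : weightedDegree wt wx we a ≤ weightedDegree wt wx we ((β, α), i) := by
    rcases (hgt _ _).1 hb with h | h
    · exact h.le
    · exact h.1.ge
  simp only [weightedDegree, Set.mem_ofPred_eq] at hw ⊢
  linarith

theorem IsWeighted.exists_lm {ord : MonomialOrdering m n s} (hord : ord.IsWeighted)
    {f : MixedModule R m n s} (h0 : f ≠ 0) : ∃ a, ord.lm f = some a :=
   MonomialOrdering.exists_lm (hord.upFinite (degX f)) (fun _ ha => degree_le_degX ha) h0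

theorem IsWeighted.upFinite_homogenized {ord : MonomialOrdering m n s} (hord : ord.IsWeighted)
    (D : ℕ) : ord.homogenized.UpFinite {a | a.1.2.degree = D} := by
  have htail : ∀ α : Fin (n + 1) →₀ ℕ, α.tail.degree ≤ α.degree := by
    intro α
    simp [Finsupp.degree_eq_sum, Fin.sum_univ_succ, Finsupp.tail_apply]
  intro a ha
  refine Set.Finite.of_finite_image (f := monDehomogenization)
    ((hord.upFinite D (monDehomogenization a) ?_).subset ?_) ?_
  · exact (htail _).trans ha.le
  · rintro _ ⟨b, ⟨hb, hba⟩, rfl⟩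
    refine ⟨(htail _).trans (le_of_eq hb), ?_⟩
    rcases hba with h | h
    · exact absurd h (by rw [ha, hb]; exact lt_irrefl _)
    · exact h.2
  · intro b hb c hc h
    exact monDehomogenization_inj (hb.1.trans hc.1.symm) h

end UpFinite

end MonomialOrdering

/-! ### Homogeneous division -/

theorem exists_isGroundDivision {R : Type*} [CommRing R] {k : ℕ} (D : Finset (Fin k))
    (c : Fin k → R) {b : R} (h : b ∈ Ideal.span (c '' D)) : ∃ a, IsGroundDivision b D c a := by
  classical
  induction D using Finset.induction_on_max generalizing b with
  | empty =>
    refine ⟨0, ?_, by simp⟩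
    simpa using h
  | insert i D hi ih =>
    have hiD : i ∉ D := fun h' => lt_irrefl _ (hi i h')
    -- The coefficient of the last generator is dropped if it is not needed.
    obtain ⟨r, z, hz, rfl, hr⟩ : ∃ r z, z ∈ Ideal.span (c '' D) ∧ b = r * c i + z ∧
        (r * c i ≠ 0 → r * c i ∉ Ideal.span (c '' D)) := by
      rw [Finset.coe_insert, Set.image_insert_eq, Ideal.mem_span_insert] at h
      obtain ⟨r, z, hz, rfl⟩ := h
      by_cases hr : r * c i ∈ Ideal.span (c '' D)
      · exact ⟨0, r * c i + z, Ideal.add_mem _ hr hz, by simp, by simp⟩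
      · exact ⟨r, z, hz, rfl, fun _ => hr⟩
    obtain ⟨a, ha, ha'⟩ := ih hz
    have hne : ∀ j ∈ D, Function.update a i r j = a j := fun j hj =>
      Function.update_of_ne (hi j hj).ne _ _
    refine ⟨Function.update a i r, ?_, ?_⟩
    · rw [Finset.sum_insert hiD, Function.update_self, ha]
      exact congrArg _ (Finset.sum_congr rfl fun j hj => by rw [hne j hj])
    · intro j hj
      rw [Finset.mem_insert] at hj
      rcases hj with rfl | hj
      · rw [Function.update_self]
        have : {x | x ∈ insert j D ∧ x < j} = (D : Set (Fin k)) := by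
          ext x
          simp only [Finset.mem_insert, Set.mem_ofPred_eq, Finset.mem_coe]
          constructor
          · rintro ⟨rfl | h, h'⟩
            · exact absurd h' (lt_irrefl _)
            · exact h
          · exact fun h => ⟨Or.inr h, hi x h⟩
        rwa [this]
      · rw [hne j hj]
        have : {x | x ∈ insert i D ∧ x < j} = {x | x ∈ D ∧ x < j} := by
          ext x
          simp only [Finset.mem_insert, Set.mem_ofPred_eq]
          constructor
          · rintro ⟨rfl | h, h'⟩
            · exact absurd (h'.trans (hi j hj)) (lt_irrefl _)
            · exact ⟨h, h'⟩
          · exact fun h => ⟨Or.inr h.1, h.2⟩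
        rw [this]
        exact ha' j hj

section Step

variable {R : Type*} [CommRing R] {m n s k : ℕ} {ord : MonomialOrdering m n s}
  {g : Fin k → MixedModule R m n s}

theorem lmDvd_iff {f h : MixedModule R m n s} {a : ModMon m n s} (ha : ord.lm f = some a) :
    ord.LmDvd h f ↔ ∃ b, ord.lm h = some b ∧ b.2 = a.2 ∧ b.1 ≤ a.1 := by
  simp [MonomialOrdering.LmDvd, ha]

theorem lcIdeal_eq {f : MixedModule R m n s} {a : ModMon m n s} (ha : ord.lm f = some a)
    (D : Set (Fin k)) : ord.lcIdeal g D a =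
      Ideal.span ((fun i => ord.lc (g i)) '' {i ∈ D | ord.LmDvd (g i) f}) := by
  simp only [lmDvd_iff ha, MonomialOrdering.lcIdeal]

theorem lt_mem_ltSpan_iff {f : MixedModule R m n s} {a : ModMon m n s} (ha : ord.lm f = some a)
    (D : Set (Fin k)) : ord.lt f ∈ ord.ltSpan g D ↔ ord.lc f ∈ ord.lcIdeal g D a := by
  rw [MonomialOrdering.lt_of_lm ha, MonomialOrdering.modTerm_mem_ltSpan_iff,
    MonomialOrdering.lc_of_lm ha]

variable (ord g) in
theorem exists_HDDwRStep (f : MixedModule R m n s) :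
    ∃ (q : Fin k → MixedRing R m n) (r f' : MixedModule R m n s), HDDwRStep ord g f q r f' := by
  classical
  by_cases h0 : f = 0
  · exact ⟨0, 0, 0, Or.inl ⟨h0, rfl, rfl, rfl⟩⟩
  by_cases h : ord.lt f ∈ ord.ltSpan g Set.univ
  · obtain ⟨a, ha⟩ : ∃ a, IsGroundDivision (ord.lc f) {i | ord.LmDvd (g i) f}
        (fun i => ord.lc (g i)) a := by
      refine exists_isGroundDivision _ _ ?_
      rcases hlm : ord.lm f with _ | d
      · simp [MonomialOrdering.lc, hlm]
      · rw [lt_mem_ltSpan_iff hlm, lcIdeal_eq hlm] at h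
        simpa using h
    have hq : ∀ i, ∃ q : MixedRing R m n, (ord.LmDvd (g i) f → ∀ d ∈ ord.lm f,
        ∀ b ∈ ord.lm (g i), q = ringTerm (d.1 - b.1) (a i)) ∧ (¬ ord.LmDvd (g i) f → q = 0) := by
      intro i
      by_cases hi : ord.LmDvd (g i) f
      · obtain ⟨b, hb, d, hd, -⟩ := id hi
        refine ⟨ringTerm (d.1 - b.1) (a i), fun _ d' hd' b' hb' => ?_, fun h => absurd hi h⟩
        rw [Option.mem_unique hd hd', Option.mem_unique hb hb']
      · exact ⟨0, fun h => absurd h hi, fun _ => rfl⟩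
    choose q hq using hq
    exact ⟨q, 0, _, Or.inr ⟨h0, rfl, Or.inl ⟨h, rfl, a, ha, hq⟩⟩⟩
  · exact ⟨0, ord.lt f, _, Or.inr ⟨h0, rfl, Or.inr ⟨h, rfl, rfl⟩⟩⟩

/-- All monomials of `f` have `x`-degree `D`; in particular `0` is homogeneous of each degree. -/
def IsHom (D : ℕ) (f : MixedModule R m n s) : Prop :=
  ∀ a, modCoeff f a ≠ 0 → a.1.2.degree = D

theorem IsHom.lt (f : MixedModule R m n s) : ∃ D, IsHom D (ord.lt f) := by
  rcases h : ord.lm f with _ | a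
  · exact ⟨0, fun b hb => by simp [MonomialOrdering.lt_eq_zero_of_lm h] at hb⟩
  · refine ⟨a.1.2.degree, fun b hb => ?_⟩
    rw [Option.some.inj (h.symm.trans (MonomialOrdering.modCoeff_lt_ne_zero hb))]

/-- The multiplier `q i` of a step is a term whose product with the leading monomial of `g i` is the
leading monomial of the current element. -/
theorem HDDwRStep.lm_eq {f r f' : MixedModule R m n s} {q : Fin k → MixedRing R m n}
    (h : HDDwRStep ord g f q r f') {a : ModMon m n s} (ha : ord.lm f = some a) {i : Fin k}
    {b : Mon m n} (hb : ringCoeff (q i) b ≠ 0) :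
    ∃ a', ord.lm (g i) = some a' ∧ a = (b + a'.1, a'.2) := by
  rcases h with ⟨-, rfl, -⟩ | ⟨-, -, ⟨-, -, c, -, hq⟩ | ⟨-, rfl, -⟩⟩
  · simp at hb
  · by_cases hi : ord.LmDvd (g i) f
    · obtain ⟨a', ha', h2, h1⟩ := (lmDvd_iff ha).1 hi
      refine ⟨a', ha', ?_⟩
      rw [(hq i).1 hi a ha a' ha', ringCoeff_ringTerm] at hb
      rw [of_not_not (fun h => hb (if_neg h)), tsub_add_cancel_of_le h1, h2]
    · rw [(hq i).2 hi] at hb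
      simp at hb
  · simp at hb

theorem HDDwRStep.remainder {f r f' : MixedModule R m n s} {q : Fin k → MixedRing R m n}
    (h : HDDwRStep ord g f q r f') {b : ModMon m n s} (hb : modCoeff r b ≠ 0) :
    ord.lm f = some b ∧ modCoeff r b = modCoeff f b ∧ ord.lt f ∉ ord.ltSpan g Set.univ := by
  rcases h with ⟨-, -, rfl, -⟩ | ⟨-, -, ⟨-, rfl, -⟩ | ⟨h, -, rfl⟩⟩
  · simp at hb
  · simp at hb
  · have hlm := MonomialOrdering.modCoeff_lt_ne_zero hb
    refine ⟨hlm, ?_, h⟩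
    rw [MonomialOrdering.lt_of_lm hlm, modCoeff_modTerm, if_pos rfl]

/-- A step cancels the leading term and preserves homogeneity. -/
theorem HDDwRStep.gt_of_ne_zero {f r f' : MixedModule R m n s} {q : Fin k → MixedRing R m n}
    (h : HDDwRStep ord g f q r f') (hg : ∀ i, ∃ d, IsHom d (g i)) {D : ℕ} (hf : IsHom D f)
    {a : ModMon m n s} (ha : ord.lm f = some a) {b : ModMon m n s} (hb : modCoeff f' b ≠ 0) :
    b.1.2.degree = D ∧ ord.gt a b := by
  classical
  have haf := MonomialOrdering.lm_eq_some_iff.1 ha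
  have hD : a.1.2.degree = D := hf a haf.1
  have hf' : f' = f - (∑ i, q i • g i + r) := by
    rcases h with ⟨rfl, rfl, rfl, rfl⟩ | ⟨-, rfl, -⟩
    · simp
    · rfl
  have hqg : ∀ i c, modCoeff (q i • g i) c ≠ 0 → c.1.2.degree = D ∧ ord.ge a c := by
    intro i c hc
    obtain ⟨b₁, b₂, hsum, h1, h2⟩ := exists_of_modCoeff_smul_ne_zero hc
    obtain ⟨a', ha', rfl⟩ := h.lm_eq ha h1
    obtain ⟨d, hd⟩ := hg i
    have ha'' := MonomialOrdering.lm_eq_some_iff.1 ha'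
    have e1 := hd _ ha''.1
    have e2 := hd _ h2
    obtain ⟨⟨cβ, cα⟩, j⟩ := c
    simp only at hsum e2
    constructor
    · rw [← hD, ← hsum]
      simp only [Prod.snd_add, map_add, e1, e2]
    · have := MonomialOrdering.ge_mul b₁ (ha''.2 _ h2)
      rwa [hsum] at this
  have hall : b.1.2.degree = D ∧ ord.ge a b := by
    rw [hf', modCoeff_sub, modCoeff_add, modCoeff_sum] at hb
    by_cases h1 : modCoeff f b ≠ 0
    · exact ⟨hf b h1, haf.2 b h1⟩
    by_cases h2 : modCoeff r b ≠ 0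
    · obtain rfl : a = b := Option.some.inj (ha.symm.trans (h.remainder h2).1)
      exact ⟨hD, MonomialOrdering.ge_refl _⟩
    rw [not_not] at h1 h2
    rw [h1, h2, zero_sub, add_zero] at hb
    obtain ⟨i, -, hi⟩ := Finset.exists_ne_zero_of_sum_ne_zero (neg_ne_zero.1 hb)
    exact hqg i b hi
  refine ⟨hall.1, hall.2.resolve_left ?_⟩
  rintro rfl
  refine hb ?_
  rcases h with ⟨rfl, rfl, rfl, rfl⟩ | ⟨-, -, ⟨-, rfl, c, hc, hq⟩ | ⟨-, rfl, rfl⟩⟩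
  · simp
  · rw [hf', add_zero, modCoeff_sub, sub_eq_zero, ← MonomialOrdering.lc_of_lm ha, hc.1,
      modCoeff_sum, Finset.sum_filter]
    refine Finset.sum_congr rfl fun i _ => ?_
    beta_reduce
    split_ifs with hi
    · obtain ⟨a', ha', h2, h1⟩ := (lmDvd_iff ha).1 hi
      rw [(hq i).1 hi a ha a' ha', MonomialOrdering.lc_of_lm ha']
      have := modCoeff_ringTerm_smul (a.1 - a'.1) a'.1 a'.2 (c i) (g i)
      rw [tsub_add_cancel_of_le h1, h2] at this
      rw [this, ← h2]
    · rw [(hq i).2 hi, zero_smul, modCoeff_zero]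
  · rw [hf', modCoeff_sub, sub_eq_zero, MonomialOrdering.lt_of_lm ha]
    simp [modCoeff_modTerm]

end Step

section Run

variable {R : Type*} [CommRing R] {m n s k : ℕ} {ord : MonomialOrdering m n s}
  {g : Fin k → MixedModule R m n s} {F : ℕ → MixedModule R m n s}
  {q : ℕ → Fin k → MixedRing R m n} {ρ : ℕ → MixedModule R m n s} {D : ℕ}

theorem HDDwRStep.eq_zero {f r f' : MixedModule R m n s} {q : Fin k → MixedRing R m n}
    (h : HDDwRStep ord g f q r f') (h0 : f = 0) : q = 0 ∧ r = 0 ∧ f' = 0 :=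
  h.elim (fun h => h.2) fun h => absurd h0 h.1

theorem isHom_of_steps (hup : ord.UpFinite {a | a.1.2.degree = D})
    (hg : ∀ i, ∃ d, IsHom d (g i)) (h0 : IsHom D (F 0))
    (hF : ∀ ν, HDDwRStep ord g (F ν) (q ν) (ρ ν) (F (ν + 1))) (ν : ℕ) : IsHom D (F ν) := by
  induction ν with
  | zero => exact h0
  | succ ν ih =>
    intro b hb
    by_cases hz : F ν = 0
    · simp [((hF ν).eq_zero hz).2.2] at hb
    · obtain ⟨a, ha⟩ := MonomialOrdering.exists_lm hup ih hz
      exact ((hF ν).gt_of_ne_zero hg ih ha hb).1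

/-- The leading monomials strictly decrease during a homogeneous division. -/
theorem gt_of_steps (hup : ord.UpFinite {a | a.1.2.degree = D})
    (hg : ∀ i, ∃ d, IsHom d (g i)) (h0 : IsHom D (F 0))
    (hF : ∀ ν, HDDwRStep ord g (F ν) (q ν) (ρ ν) (F (ν + 1))) {ν μ : ℕ} (hνμ : ν < μ)
    {b : ModMon m n s} (hb : modCoeff (F μ) b ≠ 0) : ∃ a, ord.lm (F ν) = some a ∧ ord.gt a b := by
  have hhom := isHom_of_steps hup hg h0 hF
  have hstep : ∀ μ b, modCoeff (F (μ + 1)) b ≠ 0 → ∃ a, ord.lm (F μ) = some a ∧ ord.gt a b := by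
    intro μ b hb
    by_cases hz : F μ = 0
    · simp [((hF μ).eq_zero hz).2.2] at hb
    · obtain ⟨a, ha⟩ := MonomialOrdering.exists_lm hup (hhom μ) hz
      exact ⟨a, ha, ((hF μ).gt_of_ne_zero hg (hhom μ) ha hb).2⟩
  induction μ, hνμ using Nat.le_induction generalizing b with
  | base => exact hstep ν b hb
  | succ μ hμ ih =>
    obtain ⟨a, ha, hab⟩ := hstep μ b hb
    obtain ⟨a', ha', haa⟩ := ih (MonomialOrdering.lm_eq_some_iff.1 ha).1
    exact ⟨a', ha', ord.trans _ _ _ haa hab⟩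

/-- The elements `F ν` of a homogeneous division converge to `0` in the `⟨t⟩`-adic topology. -/
theorem exists_forall_modCoeff_eq_zero (hup : ord.UpFinite {a | a.1.2.degree = D})
    (hg : ∀ i, ∃ d, IsHom d (g i)) (h0 : IsHom D (F 0))
    (hF : ∀ ν, HDDwRStep ord g (F ν) (q ν) (ρ ν) (F (ν + 1))) (N : ℕ) :
    ∃ M, ∀ ν ≥ M, ∀ a : ModMon m n s, a.1.1.degree < N → modCoeff (F ν) a = 0 := by
  have hhom := isHom_of_steps hup hg h0 hF
  -- A monomial of degree `D` occurs in finitely many `F ν` only, because the leading monomials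
  -- above it are distinct elements of a finite set.
  have hfin : ∀ b : ModMon m n s, b.1.2.degree = D → {ν | modCoeff (F ν) b ≠ 0}.Finite := by
    intro b hb
    refine Set.Finite.of_injOn (f := fun ν => ord.lm (F ν)) (t := some '' (insert b
      {a | a.1.2.degree = D ∧ ord.gt a b})) ?_ ?_ (((hup b hb).insert b).image _)
    · intro ν hν
      obtain ⟨a, ha⟩ := MonomialOrdering.exists_lm hup (hhom ν)
        (fun h => hν (by rw [h, modCoeff_zero]))
      have ha' := MonomialOrdering.lm_eq_some_iff.1 ha
      refine ⟨a, ?_, ha.symm⟩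
      rcases ha'.2 b hν with rfl | h
      · exact Set.mem_insert _ _
      · exact Set.mem_insert_of_mem _ ⟨hhom ν a ha'.1, h⟩
    · intro ν hν μ hμ hνμ
      have key : ∀ ν μ, modCoeff (F μ) b ≠ 0 → ord.lm (F ν) = ord.lm (F μ) → ¬ ν < μ := by
        intro ν μ hμ heq hlt
        obtain ⟨a, ha⟩ := MonomialOrdering.exists_lm hup (hhom μ)
          (fun h => hμ (by rw [h, modCoeff_zero]))
        obtain ⟨a', ha', hgt⟩ := gt_of_steps hup hg h0 hF hlt
          (MonomialOrdering.lm_eq_some_iff.1 ha).1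
        obtain rfl : a = a' := Option.some.inj (ha.symm.trans (heq.symm.trans ha'))
        exact ord.irrefl _ hgt
      exact le_antisymm (not_lt.1 (key μ ν hν hνμ.symm)) (not_lt.1 (key ν μ hμ hνμ))
  have hfin' : {b : ModMon m n s | b.1.1.degree ≤ N ∧ b.1.2.degree = D}.Finite := by
    refine (((finite_setOf_degree_le m N).prod (finite_setOf_degree_le n D)).prod
      (Set.finite_univ (α := Fin s))).subset ?_
    rintro b ⟨h1, h2⟩
    exact ⟨⟨h1, h2.le⟩, trivial⟩
  obtain ⟨M, hM⟩ := (hfin'.biUnion fun b hb => hfin b hb.2).bddAbove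
  refine ⟨M + 1, fun ν hν a ha => ?_⟩
  by_contra hne
  have : ν ≤ M := hM (Set.mem_biUnion (x := a) ⟨ha.le, hhom ν a hne⟩ hne)
  omega

theorem tendsToZero_quotients (hup : ord.UpFinite {a | a.1.2.degree = D})
    (hg : ∀ i, ∃ d, IsHom d (g i)) (h0 : IsHom D (F 0))
    (hF : ∀ ν, HDDwRStep ord g (F ν) (q ν) (ρ ν) (F (ν + 1))) (i : Fin k) :
    TendsToZero fun ν => q ν i := by
  intro N
  rcases hlm : ord.lm (g i) with _ | a'
  · refine ⟨0, fun ν _ b _ => ?_⟩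
    by_contra hne
    by_cases hz : F ν = 0
    · simp [((hF ν).eq_zero hz).1] at hne
    · obtain ⟨a, ha⟩ := MonomialOrdering.exists_lm hup (isHom_of_steps hup hg h0 hF ν) hz
      obtain ⟨a', ha', -⟩ := (hF ν).lm_eq ha hne
      simp [ha'] at hlm
  · obtain ⟨M, hM⟩ := exists_forall_modCoeff_eq_zero hup hg h0 hF (N + a'.1.1.degree)
    refine ⟨M, fun ν hν b hb => ?_⟩
    by_contra hne
    by_cases hz : F ν = 0
    · simp [((hF ν).eq_zero hz).1] at hne
    · obtain ⟨a, ha⟩ := MonomialOrdering.exists_lm hup (isHom_of_steps hup hg h0 hF ν) hz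
      obtain ⟨a'', ha'', rfl⟩ := (hF ν).lm_eq ha hne
      obtain rfl : a' = a'' := Option.some.inj (hlm.symm.trans ha'')
      refine (MonomialOrdering.lm_eq_some_iff.1 ha).1 (hM ν hν _ ?_)
      simpa using hb

theorem tendsToZero_remainders (hup : ord.UpFinite {a | a.1.2.degree = D})
    (hg : ∀ i, ∃ d, IsHom d (g i)) (h0 : IsHom D (F 0))
    (hF : ∀ ν, HDDwRStep ord g (F ν) (q ν) (ρ ν) (F (ν + 1))) (j : Fin s) :
    TendsToZero fun ν => ρ ν j := by
  intro N
  obtain ⟨M, hM⟩ := exists_forall_modCoeff_eq_zero hup hg h0 hF N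
  refine ⟨M, fun ν hν b hb => ?_⟩
  by_contra hne
  have := (hF ν).remainder (b := (b, j)) hne
  exact hne (this.2.1.trans (hM ν hν (b, j) hb))

/-- The homogeneous division converges. -/
theorem exists_HDDwR (hup : ord.UpFinite {a | a.1.2.degree = D}) (hg : ∀ i, ∃ d, IsHom d (g i))
    {f : MixedModule R m n s} (hf : IsHom D f) : ∃ Q r, HDDwR ord f g Q r := by
  choose nq nr nf hn using exists_HDDwRStep ord g
  let F : ℕ → MixedModule R m n s := fun ν => nf^[ν] f
  have hF : ∀ ν, HDDwRStep ord g (F ν) (nq (F ν)) (nr (F ν)) (F (ν + 1)) := by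
    intro ν
    have : F (ν + 1) = nf (F ν) := Function.iterate_succ_apply' _ _ _
    rw [this]
    exact hn _
  have hhom := isHom_of_steps (F := F) hup hg hf hF
  have hQ : ∀ i, ∃ P, HasTAdicSum (fun ν => nq (F ν) i) P := by
    intro i
    refine exists_hasTAdicSum (tendsToZero_quotients (F := F) hup hg hf hF i) D fun ν b hb => ?_
    by_cases hz : F ν = 0
    · simp [((hF ν).eq_zero hz).1] at hb
    · obtain ⟨a, ha⟩ := MonomialOrdering.exists_lm hup (hhom ν) hz
      obtain ⟨a', -, rfl⟩ := (hF ν).lm_eq ha hb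
      rw [← hhom ν _ (MonomialOrdering.lm_eq_some_iff.1 ha).1]
      simp
  have hR : ∀ j, ∃ P, HasTAdicSum (fun ν => nr (F ν) j) P := by
    intro j
    refine exists_hasTAdicSum (tendsToZero_remainders (F := F) hup hg hf hF j) D fun ν b hb => ?_
    have := (hF ν).remainder (b := (b, j)) hb
    exact (hhom ν (b, j) (this.2.1 ▸ hb)).le
  choose Q hQ using hQ
  choose r hr using hR
  exact ⟨Q, r, F, _, _, rfl, hF, hQ, hr⟩

/-- The difference of both sides lies in every power of `⟨t⟩`, hence it vanishes. -/
theorem HDDwR.eq (hup : ord.UpFinite {a | a.1.2.degree = D}) (hg : ∀ i, ∃ d, IsHom d (g i))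
    {f r : MixedModule R m n s} (hf : IsHom D f) {Q : Fin k → MixedRing R m n}
    (h : HDDwR ord f g Q r) : f = ∑ i, Q i • g i + r := by
  obtain ⟨F, q, ρ, rfl, hF, hQ, hr⟩ := h
  have hsum : ∀ K, F 0 =
      ∑ i, (∑ ν ∈ Finset.range K, q ν i) • g i + ∑ ν ∈ Finset.range K, ρ ν + F K := by
    intro K
    induction K with
    | zero => simp
    | succ K ih =>
      have : F (K + 1) = F K - (∑ i, q K i • g i + ρ K) := by
        rcases hF K with ⟨h1, h2, h3, h4⟩ | ⟨-, h, -⟩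
        · simp [h1, h2, h3, h4]
        · exact h
      rw [this]
      simp only [Finset.sum_range_succ, add_smul, Finset.sum_add_distrib]
      nth_rw 1 [ih]
      abel
  refine sub_eq_zero.1 (modExt fun a => ?_)
  obtain ⟨⟨β, α⟩, j⟩ := a
  set N := β.degree + 1
  obtain ⟨M₀, hM₀⟩ := exists_forall_modCoeff_eq_zero hup hg hf hF N
  choose M hM using fun i => hQ i N
  obtain ⟨M₁, hM₁⟩ := hr j N
  set K := M₀ + M₁ + ∑ i, M i
  have hMK : ∀ i, M i ≤ K := fun i => by
    have := Finset.single_le_sum (f := M) (fun _ _ => Nat.zero_le _) (Finset.mem_univ i)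
    omega
  have e1 : F 0 - (∑ i, Q i • g i + r) =
      F K - ∑ i, (Q i - ∑ ν ∈ Finset.range K, q ν i) • g i -
        (r - ∑ ν ∈ Finset.range K, ρ ν) := by
    have hsub : ∀ i, (Q i - ∑ ν ∈ Finset.range K, q ν i) • g i =
        Q i • g i - (∑ ν ∈ Finset.range K, q ν i) • g i := fun i =>
      funext fun j => sub_mul (Q i) _ (g i j)
    rw [Finset.sum_congr rfl fun i _ => hsub i, Finset.sum_sub_distrib]
    conv_lhs => rw [hsum K]
    abel
  have hmem : (F K - ∑ i, (Q i - ∑ ν ∈ Finset.range K, q ν i) • g i -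
        (r - ∑ ν ∈ Finset.range K, ρ ν)) j ∈ tIdeal R m n ^ N := by
    rw [Pi.sub_apply, Pi.sub_apply, Pi.sub_apply, Finset.sum_apply, Finset.sum_apply]
    refine Ideal.sub_mem _ (Ideal.sub_mem _ ?_ ?_) (hM₁ K (by omega))
    · exact mem_tIdeal_pow_iff.2 fun a ha => hM₀ K (by omega) (a, j) ha
    · exact Ideal.sum_mem _ fun i _ => Ideal.mul_mem_right _ _ (hM i K (hMK i))
  rw [e1, modCoeff_zero]
  exact mem_tIdeal_pow_iff.1 hmem (β, α) (Nat.lt_succ_self _)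

/-- The monomials of the quotients of a homogeneous division satisfy a strong form of (ID1), which
refers to products of monomials instead of leading monomials of products. -/
theorem HDDwR.quotient (hup : ord.UpFinite {a | a.1.2.degree = D})
    (hg : ∀ i, ∃ d, IsHom d (g i)) {f r : MixedModule R m n s} (hf : IsHom D f)
    {Q : Fin k → MixedRing R m n} (h : HDDwR ord f g Q r) {i : Fin k} {b : Mon m n}
    (hb : ringCoeff (Q i) b ≠ 0) :
    ∃ a', ord.lm (g i) = some a' ∧ (b + a'.1).2.degree = D ∧
      ∃ a, ord.lm f = some a ∧ ord.ge a (b + a'.1, a'.2) := by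
  obtain ⟨F, q, ρ, rfl, hF, hQ, -⟩ := h
  have hhom := isHom_of_steps hup hg hf hF
  obtain ⟨M, hM⟩ := (hQ i).exists_ringCoeff_eq b
  rw [hM M le_rfl] at hb
  obtain ⟨ν, -, hν⟩ := Finset.exists_ne_zero_of_sum_ne_zero hb
  by_cases hz : F ν = 0
  · simp [((hF ν).eq_zero hz).1] at hν
  · obtain ⟨a, ha⟩ := MonomialOrdering.exists_lm hup (hhom ν) hz
    obtain ⟨a', ha', rfl⟩ := (hF ν).lm_eq ha hν
    have hne := (MonomialOrdering.lm_eq_some_iff.1 ha).1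
    refine ⟨a', ha', hhom ν _ hne, ?_⟩
    rcases Nat.eq_zero_or_pos ν with rfl | hpos
    · exact ⟨_, ha, MonomialOrdering.ge_refl _⟩
    · obtain ⟨a, h1, h2⟩ := gt_of_steps hup hg hf hF hpos hne
      exact ⟨a, h1, Or.inr h2⟩

/-- No term of the remainder of a homogeneous division is in the module of leading terms, and only
an irreducible leading term of `f` reappears in the remainder. -/
theorem HDDwR.remainder (hup : ord.UpFinite {a | a.1.2.degree = D})
    (hg : ∀ i, ∃ d, IsHom d (g i)) {f r : MixedModule R m n s} (hf : IsHom D f)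
    {Q : Fin k → MixedRing R m n} (h : HDDwR ord f g Q r) {b : ModMon m n s}
    (hb : modCoeff r b ≠ 0) :
    modTerm b (modCoeff r b) ∉ ord.ltSpan g Set.univ ∧ b.1.2.degree = D ∧
      ∃ a, ord.lm f = some a ∧ (a = b ∧ ord.lt f ∉ ord.ltSpan g Set.univ ∨ ord.gt a b) := by
  obtain ⟨F, q, ρ, rfl, hF, -, hr⟩ := h
  have hhom := isHom_of_steps hup hg hf hF
  obtain ⟨M, hM⟩ := (hr b.2).exists_ringCoeff_eq b.1
  change ∀ K ≥ M, modCoeff r b = ∑ ν ∈ Finset.range K, modCoeff (ρ ν) b at hM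
  obtain ⟨ν, -, hν⟩ := Finset.exists_ne_zero_of_sum_ne_zero (hM M le_rfl ▸ hb)
  obtain ⟨hlm, hco, hirr⟩ := (hF ν).remainder hν
  have hne := (MonomialOrdering.lm_eq_some_iff.1 hlm).1
  have hrb : modCoeff r b = modCoeff (F ν) b := by
    rw [hM (M + (ν + 1)) (by omega), ← hco]
    refine Finset.sum_eq_single ν ?_ ?_
    · intro μ _ hμ
      by_contra hμb
      have hlm' := ((hF μ).remainder hμb).1
      have hne' := (MonomialOrdering.lm_eq_some_iff.1 hlm').1
      rcases lt_or_gt_of_ne hμ with hlt | hlt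
      · obtain ⟨a, ha, hgt⟩ := gt_of_steps hup hg hf hF hlt hne
        obtain rfl : b = a := Option.some.inj (hlm'.symm.trans ha)
        exact ord.irrefl _ hgt
      · obtain ⟨a, ha, hgt⟩ := gt_of_steps hup hg hf hF hlt hne'
        obtain rfl : b = a := Option.some.inj (hlm.symm.trans ha)
        exact ord.irrefl _ hgt
    · intro hμ
      exact absurd (Finset.mem_range.2 (by omega)) hμ
  refine ⟨?_, hhom ν b hne, ?_⟩
  · rw [hrb, ← MonomialOrdering.lt_of_lm hlm]
    exact hirr
  · rcases Nat.eq_zero_or_pos ν with rfl | hpos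
    · exact ⟨b, hlm, Or.inl ⟨rfl, hirr⟩⟩
    · obtain ⟨a, h1, h2⟩ := gt_of_steps hup hg hf hF hpos hne
      exact ⟨a, h1, Or.inr h2⟩

end Run

/-! ### Homogenization and dehomogenization -/

section Homogenization

variable {R : Type*} [CommRing R] {m n s : ℕ}

theorem ringDehomogenization_monomial (α : Fin (n + 1) →₀ ℕ) (c : MvPowerSeries (Fin m) R) :
    (ringDehomogenization (MvPolynomial.monomial α c) : MixedRing R m n) =
      MvPolynomial.monomial α.tail c := by
  rw [ringDehomogenization, MvPolynomial.aeval_monomial, MvPolynomial.monomial_eq,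
    Finsupp.prod_fintype _ _ (fun _ => pow_zero _), Finsupp.prod_fintype _ _ (fun _ => pow_zero _),
    Fin.prod_univ_succ]
  simp [Finsupp.tail_apply, MvPolynomial.algebraMap_eq]

theorem coeff_ringDehomogenization (P : MixedRing R m (n + 1)) (γ : Fin n →₀ ℕ) :
    MvPolynomial.coeff γ (ringDehomogenization P) =
      ∑ α ∈ P.support with α.tail = γ, MvPolynomial.coeff α P := by
  conv_lhs => rw [P.as_sum]
  rw [map_sum, MvPolynomial.coeff_sum, Finset.sum_filter]
  simp only [ringDehomogenization_monomial, MvPolynomial.coeff_monomial]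

theorem exists_of_ringCoeff_ringDehomogenization_ne_zero {P : MixedRing R m (n + 1)} {b : Mon m n}
    (h : ringCoeff (ringDehomogenization P) b ≠ 0) :
    ∃ B : Mon m (n + 1), B.1 = b.1 ∧ B.2.tail = b.2 ∧ ringCoeff P B ≠ 0 := by
  rw [ringCoeff, coeff_ringDehomogenization, map_sum] at h
  obtain ⟨α, hα, hne⟩ := Finset.exists_ne_zero_of_sum_ne_zero h
  exact ⟨(b.1, α), rfl, (Finset.mem_filter.1 hα).2, hne⟩

theorem exists_of_modCoeff_dehomogenization_ne_zero {F : MixedModule R m (n + 1) s}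
    {a : ModMon m n s} (h : modCoeff (dehomogenization F) a ≠ 0) :
    ∃ A, monDehomogenization A = a ∧ modCoeff F A ≠ 0 := by
  obtain ⟨B, h1, h2, h3⟩ := exists_of_ringCoeff_ringDehomogenization_ne_zero h
  exact ⟨(B, a.2), Prod.ext (Prod.ext h1 h2) rfl, h3⟩

/-- On homogeneous elements, dehomogenization does not merge monomials. -/
theorem modCoeff_dehomogenization {F : MixedModule R m (n + 1) s} {D : ℕ} (hF : IsHom D F)
    {A : ModMon m (n + 1) s} (hA : A.1.2.degree = D) :
    modCoeff (dehomogenization F) (monDehomogenization A) = modCoeff F A := by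
  obtain ⟨⟨β, α⟩, i⟩ := A
  simp only [modCoeff, dehomogenization, monDehomogenization, ringCoeff,
    coeff_ringDehomogenization, map_sum]
  refine Finset.sum_eq_single α ?_ ?_
  · intro γ hγ hne
    by_contra hc
    have hd : γ.degree = D := hF ((β, γ), i) hc
    have := monDehomogenization_inj (a := ((β, γ), i)) (b := ((β, α), i)) (hd.trans hA.symm)
      (by simp only [monDehomogenization, (Finset.mem_filter.1 hγ).2])
    simp only [Prod.mk.injEq, true_and, and_true] at this
    exact hne this
  · intro hα
    have : MvPolynomial.coeff α (F i) = 0 := by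
      by_contra hc
      exact hα (Finset.mem_filter.2 ⟨MvPolynomial.mem_support_iff.2 hc, rfl⟩)
    rw [this, map_zero]

theorem degree_eq_add_degree_tail (α : Fin (n + 1) →₀ ℕ) : α.degree = α 0 + α.tail.degree := by
  simp [Finsupp.degree_eq_sum, Fin.sum_univ_succ, Finsupp.tail_apply]

theorem degree_cons (d : ℕ) (α : Fin n →₀ ℕ) : (Finsupp.cons d α).degree = d + α.degree := by
  rw [degree_eq_add_degree_tail, Finsupp.cons_zero, Finsupp.tail_cons]

theorem isHom_homogenization (f : MixedModule R m n s) : IsHom (degX f) (homogenization f) := by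
  intro A hA
  rw [modCoeff, homogenization, ringCoeff_sum] at hA
  obtain ⟨α, hα, hne⟩ := Finset.exists_ne_zero_of_sum_ne_zero hA
  rw [ringCoeff, MvPolynomial.coeff_monomial] at hne
  have hle := degree_le_degX_of_mem_support hα
  by_cases h : Finsupp.cons (degX f - α.degree) α = A.1.2
  · rw [← h, degree_cons]
    omega
  · simp [h] at hne

theorem dehomogenization_homogenization (f : MixedModule R m n s) :
    dehomogenization (homogenization f) = f := by
  funext i
  simp only [dehomogenization, homogenization, map_sum, ringDehomogenization_monomial,
    Finsupp.tail_cons]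
  exact MvPolynomial.support_sum_monomial_coeff (f i)

theorem dehomogenization_sub (F G : MixedModule R m (n + 1) s) :
    dehomogenization (F - G) = dehomogenization F - dehomogenization G :=
  funext fun _ => map_sub _ _ _

theorem dehomogenization_sum_smul {ι : Type*} (S : Finset ι) (Q : ι → MixedRing R m (n + 1))
    (G : ι → MixedModule R m (n + 1) s) : dehomogenization (∑ i ∈ S, Q i • G i) =
      ∑ i ∈ S, ringDehomogenization (Q i) • dehomogenization (G i) := by
  funext j
  simp [dehomogenization, Finset.sum_apply]

theorem dehomogenization_X_pow_smul (e : ℕ) (F : MixedModule R m (n + 1) s) :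
    dehomogenization ((MvPolynomial.X 0 : MixedRing R m (n + 1)) ^ e • F) = dehomogenization F := by
  have : ringDehomogenization (MvPolynomial.X 0 : MixedRing R m (n + 1)) = 1 := by
    rw [ringDehomogenization, MvPolynomial.aeval_X, Fin.cons_zero]
  funext j
  simp [dehomogenization, this]

theorem IsHom.X_pow_smul {D : ℕ} {F : MixedModule R m (n + 1) s} (hF : IsHom D F) (e : ℕ) :
    IsHom (D + e) ((MvPolynomial.X 0 : MixedRing R m (n + 1)) ^ e • F) := by
  have hX : (MvPolynomial.X 0 : MixedRing R m (n + 1)) ^ e =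
      ringTerm (0, Finsupp.single 0 e) 1 := by
    rw [MvPolynomial.X_pow_eq_monomial, ringTerm, MvPowerSeries.monomial_zero_one]
  intro A hA
  rw [hX] at hA
  obtain ⟨b, c, hsum, hb, hc⟩ := exists_of_modCoeff_smul_ne_zero hA
  rw [ringCoeff_ringTerm] at hb
  rw [of_not_not (fun h => hb (if_neg h))] at hsum
  rw [← hsum, Prod.snd_add, map_add, hF _ hc, Finsupp.degree_single, add_comm]

theorem degX_dehomogenization_le {D : ℕ} {F : MixedModule R m (n + 1) s} (hF : IsHom D F) :
    degX (dehomogenization F) ≤ D := by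
  refine Finset.sup_le fun i _ => Finset.sup_le fun α hα => ?_
  obtain ⟨β, hβ⟩ : ∃ β, MvPowerSeries.coeff β (MvPolynomial.coeff α (dehomogenization F i)) ≠ 0 := by
    by_contra! h
    exact MvPolynomial.mem_support_iff.1 hα (MvPowerSeries.ext h)
  obtain ⟨A, hA, hne⟩ := exists_of_modCoeff_dehomogenization_ne_zero (a := ((β, α), i)) hβ
  have h1 : A.1.2.tail = α := congrArg (fun a : ModMon m n s => a.1.2) hA
  have h2 := degree_eq_add_degree_tail A.1.2
  rw [hF A hne, h1] at h2
  change α.degree ≤ D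
  omega

variable {ord : MonomialOrdering m n s}

theorem ge_homogenized_iff {A B : ModMon m (n + 1) s} (h : A.1.2.degree = B.1.2.degree) :
    ord.homogenized.ge A B ↔ ord.ge (monDehomogenization A) (monDehomogenization B) := by
  constructor
  · rintro (rfl | hlt | hgt)
    · exact MonomialOrdering.ge_refl _
    · omega
    · exact Or.inr hgt.2
  · rintro (heq | hgt)
    · exact Or.inl (monDehomogenization_inj h heq)
    · exact Or.inr (Or.inr ⟨h, hgt⟩)

/-- On homogeneous elements, the leading monomial with respect to `>_h` corresponds to the leading
monomial with respect to `>` of the dehomogenization. -/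
theorem lm_homogenized_iff {D : ℕ} {F : MixedModule R m (n + 1) s} (hF : IsHom D F)
    {A : ModMon m (n + 1) s} : ord.homogenized.lm F = some A ↔
      A.1.2.degree = D ∧ ord.lm (dehomogenization F) = some (monDehomogenization A) := by
  rw [MonomialOrdering.lm_eq_some_iff, MonomialOrdering.lm_eq_some_iff]
  constructor
  · rintro ⟨h1, h2⟩
    have hA := hF A h1
    refine ⟨hA, by rwa [modCoeff_dehomogenization hF hA], fun b hb => ?_⟩
    obtain ⟨B, rfl, hB⟩ := exists_of_modCoeff_dehomogenization_ne_zero hb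
    exact (ge_homogenized_iff (hA.trans (hF B hB).symm)).1 (h2 B hB)
  · rintro ⟨hA, h1, h2⟩
    rw [modCoeff_dehomogenization hF hA] at h1
    refine ⟨h1, fun B hB => ?_⟩
    rw [ge_homogenized_iff (hA.trans (hF B hB).symm)]
    exact h2 _ (by rwa [modCoeff_dehomogenization hF (hF B hB)])

theorem lc_homogenized {D : ℕ} {F : MixedModule R m (n + 1) s} (hF : IsHom D F)
    {A : ModMon m (n + 1) s} (hA : ord.homogenized.lm F = some A) :
    ord.homogenized.lc F = ord.lc (dehomogenization F) := by
  have h := (lm_homogenized_iff hF).1 hA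
  rw [MonomialOrdering.lc_of_lm hA, MonomialOrdering.lc_of_lm h.2,
    modCoeff_dehomogenization hF h.1]

theorem lm_homogenization_iff {f : MixedModule R m n s} {A : ModMon m (n + 1) s} :
    ord.homogenized.lm (homogenization f) = some A ↔
      A.1.2.degree = degX f ∧ ord.lm f = some (monDehomogenization A) := by
  rw [lm_homogenized_iff (isHom_homogenization f), dehomogenization_homogenization]

/-- The monomial of `x_h`-degree `D` that dehomogenizes to `a`; it has this degree only if the
`x`-degree of `a` is at most `D`. -/
def monHomogenization (D : ℕ) (a : ModMon m n s) : ModMon m (n + 1) s :=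
  ((a.1.1, Finsupp.cons (D - a.1.2.degree) a.1.2), a.2)

theorem monDehomogenization_monHomogenization (D : ℕ) (a : ModMon m n s) :
    monDehomogenization (monHomogenization D a) = a := by
  simp [monDehomogenization, monHomogenization]

theorem degree_monHomogenization {D : ℕ} {a : ModMon m n s} (h : a.1.2.degree ≤ D) :
    (monHomogenization D a).1.2.degree = D := by
  rw [monHomogenization, degree_cons]
  omega

theorem ecart_of_lm {f : MixedModule R m n s} {a : ModMon m n s} (h : ord.lm f = some a) :
    ord.ecart f = degX f - a.1.2.degree := by
  rw [MonomialOrdering.ecart, h]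

theorem ecart_add_degree {f : MixedModule R m n s} {a : ModMon m n s} (h : ord.lm f = some a) :
    ord.ecart f + a.1.2.degree = degX f := by
  have := degree_le_degX (MonomialOrdering.lm_eq_some_iff.1 h).1
  rw [ecart_of_lm h]
  omega

/-- The `x₀`-exponent of the leading monomial of `g^h` is the ecart of `g`. Therefore a reduction of
the leading term lifts to the homogenizations if the ecarts of the elements it uses are at most the
`x₀`-exponent of the leading monomial of `F`. -/
theorem lt_mem_ltSpan_homogenized {k : ℕ} {g : Fin k → MixedModule R m n s} {D : ℕ}
    {F : MixedModule R m (n + 1) s} (hF : IsHom D F) {a : ModMon m n s}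
    (ha : ord.lm (dehomogenization F) = some a) {E : Set (Fin k)}
    (hE : ∀ i ∈ E, ord.ecart (g i) + a.1.2.degree ≤ D)
    (h : ord.lt (dehomogenization F) ∈ ord.ltSpan g E) :
    ord.homogenized.lt F ∈ ord.homogenized.ltSpan (fun i => homogenization (g i)) E := by
  have haD : a.1.2.degree ≤ D :=
    (degree_le_degX (MonomialOrdering.lm_eq_some_iff.1 ha).1).trans (degX_dehomogenization_le hF)
  have hA : ord.homogenized.lm F = some (monHomogenization D a) := by
    rw [lm_homogenized_iff hF, monDehomogenization_monHomogenization]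
    exact ⟨degree_monHomogenization haD, ha⟩
  rw [lt_mem_ltSpan_iff hA, lc_homogenized hF hA]
  rw [lt_mem_ltSpan_iff ha] at h
  refine Ideal.span_le.2 ?_ h
  rintro _ ⟨i, ⟨hi, b, hb, hb2, hb1⟩, rfl⟩
  have hbD := degree_le_degX (MonomialOrdering.lm_eq_some_iff.1 hb).1
  have hB : ord.homogenized.lm (homogenization (g i)) =
      some (monHomogenization (degX (g i)) b) := by
    rw [lm_homogenization_iff, monDehomogenization_monHomogenization]
    exact ⟨degree_monHomogenization hbD, hb⟩
  refine Ideal.subset_span ⟨i, ⟨hi, _, hB, hb2, Prod.mk_le_mk.2 ⟨hb1.1, fun j => ?_⟩⟩, ?_⟩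
  · refine Fin.cases ?_ (fun j => ?_) j
    · have h1 := hE i hi
      rw [ecart_of_lm hb] at h1
      simp only [Finsupp.cons_zero]
      omega
    · simpa only [Finsupp.cons_succ] using hb1.2 j
  · simp only [lc_homogenized (isHom_homogenization _) hB, dehomogenization_homogenization]

end Homogenization

/-! ### The steps of the weak division -/

section Selection

variable {R : Type*} [CommRing R] {m n s k : ℕ} {ord : MonomialOrdering m n s}
  {f : MixedModule R m n s} {g : Fin k → MixedModule R m n s}

theorem exists_selection (D D' : Finset (Fin k))
    (h : ord.lt f ∈ ord.ltSpan g (D ∪ D' : Set (Fin k))) : ∃ E, Selection ord f g D D' E := by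
  induction hc : D.card generalizing D D' with
  | zero =>
    rw [Finset.card_eq_zero] at hc
    subst hc
    exact ⟨D', .done _ _ (by simpa using h)⟩
  | succ c ih =>
    by_cases h' : ord.lt f ∈ ord.ltSpan g (D' : Set (Fin k))
    · exact ⟨D', .done _ _ h'⟩
    · obtain ⟨i, hi, hmin⟩ := D.exists_min_image (fun i => ord.ecart (g i))
        (Finset.card_pos.1 (by omega))
      obtain ⟨E, hE⟩ := ih (D.erase i) (insert i D') (by
        refine MonomialOrdering.ltSpan_mono g ?_ h
        intro j hj
        simp only [Set.mem_union, Finset.mem_coe, Finset.mem_erase, Finset.mem_insert] at hj ⊢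
        tauto) (by rw [Finset.card_erase_of_mem hi, hc]; rfl)
      exact ⟨E, .pick _ _ _ i h' hi hmin hE⟩

theorem Selection.lt_mem {D D' E : Finset (Fin k)} (h : Selection ord f g D D' E) :
    ord.lt f ∈ ord.ltSpan g (E : Set (Fin k)) := by
  induction h with
  | done _ _ h => exact h
  | pick _ _ _ _ _ _ _ _ ih => exact ih

/-- The selection loop takes no ecart above `c` if the elements of ecart at most `c` suffice. -/
theorem Selection.ecart_le {D D' E : Finset (Fin k)} (h : Selection ord f g D D' E) {c : ℕ}
    (hD' : ∀ i ∈ D', ord.ecart (g i) ≤ c)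
    (hc : ord.lt f ∈ ord.ltSpan g {i | (i ∈ D ∨ i ∈ D') ∧ ord.ecart (g i) ≤ c}) :
    ∀ i ∈ E, ord.ecart (g i) ≤ c := by
  induction h with
  | done _ _ h => exact hD'
  | pick D D' E i h hi hmin _ ih =>
    have hic : ord.ecart (g i) ≤ c := by
      by_contra hic
      refine h (MonomialOrdering.ltSpan_mono g ?_ hc)
      rintro j ⟨hj | hj, hjc⟩
      · exact absurd ((hmin j hj).trans hjc) hic
      · exact hj
    refine ih ?_ (MonomialOrdering.ltSpan_mono g ?_ hc)
    · intro j hj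
      rcases Finset.mem_insert.1 hj with rfl | hj
      · exact hic
      · exact hD' j hj
    · intro j hj
      simp only [Set.mem_ofPred_eq, Finset.mem_erase, Finset.mem_insert] at hj ⊢
      tauto

theorem Reducible.lt_mem_lmDvd (hord : ord.IsWeighted) (h : Reducible ord f g) :
    ord.lt f ∈ ord.ltSpan g {i | ord.LmDvd (g i) f} := by
  obtain ⟨a, ha⟩ := hord.exists_lm h.1
  have h2 := h.2
  rw [lt_mem_ltSpan_iff ha, lcIdeal_eq ha] at h2 ⊢
  simpa using h2

theorem Reducible.exists_selectedEcart (hord : ord.IsWeighted) (h : Reducible ord f g) :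
    ∃ c, SelectedEcart ord f g c := by
  classical
  obtain ⟨E, hE⟩ := exists_selection (ord := ord) (f := f) (g := g)
    {i | ord.LmDvd (g i) f} ∅ (by simpa using h.lt_mem_lmDvd hord)
  exact ⟨_, E, hE, rfl⟩

/-- The ideal of the leading coefficients of those elements of `G` that reduce the leading monomial
of `f` without exceeding the ecart of `f`. -/
def ecartIdeal (ord : MonomialOrdering m n s) (G : Set (MixedModule R m n s))
    (f : MixedModule R m n s) : Ideal R :=
  Ideal.span (ord.lc '' {h ∈ G | ord.LmDvd h f ∧ ord.ecart h ≤ ord.ecart f})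

theorem lt_mem_ltSpan_ecart_iff {a : ModMon m n s} (ha : ord.lm f = some a) :
    ord.lt f ∈ ord.ltSpan g {i | ord.LmDvd (g i) f ∧ ord.ecart (g i) ≤ ord.ecart f} ↔
      ord.lc f ∈ ecartIdeal ord (Set.range g) f := by
  rw [lt_mem_ltSpan_iff ha, lcIdeal_eq ha, ecartIdeal]
  have : (fun i => ord.lc (g i)) '' {i ∈ {i | ord.LmDvd (g i) f ∧ ord.ecart (g i) ≤ ord.ecart f} |
      ord.LmDvd (g i) f} =
      ord.lc '' {h ∈ Set.range g | ord.LmDvd h f ∧ ord.ecart h ≤ ord.ecart f} := by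
    ext c
    constructor
    · rintro ⟨i, ⟨hi, -⟩, rfl⟩
      exact ⟨g i, ⟨⟨i, rfl⟩, hi⟩, rfl⟩
    · rintro ⟨_, ⟨⟨i, rfl⟩, hi⟩, rfl⟩
      exact ⟨i, ⟨hi, hi.1⟩, rfl⟩
  rw [this]

/-- If the maximal selected ecart exceeds `ecart(f)`, then elements of ecart at most `ecart(f)`
do not suffice to reduce `lt(f)`. -/
theorem SelectedEcart.lc_notMem (hord : ord.IsWeighted) (h : Reducible ord f g) {c : ℕ}
    (hc : SelectedEcart ord f g c) (hlt : ord.ecart f < c) :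
    ord.lc f ∉ ecartIdeal ord (Set.range g) f := by
  classical
  obtain ⟨a, ha⟩ := hord.exists_lm h.1
  obtain ⟨E, hE, rfl⟩ := hc
  rw [← lt_mem_ltSpan_ecart_iff ha]
  intro hmem
  refine absurd hlt (not_lt.2 (Finset.sup_le (hE.ecart_le (by simp) ?_)))
  simpa using hmem

theorem SelectedEcart.lt_mem {c : ℕ} (hc : SelectedEcart ord f g c) :
    ord.lt f ∈ ord.ltSpan g {i | ord.ecart (g i) ≤ c} := by
  obtain ⟨E, hE, rfl⟩ := hc
  exact MonomialOrdering.ltSpan_mono g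
    (fun i hi => Finset.le_sup (f := fun i => ord.ecart (g i)) hi) hE.lt_mem

end Selection

section Steps

variable {R : Type*} [CommRing R] {m n s k : ℕ} {ord : MonomialOrdering m n s}
  {f : MixedModule R m n s} {g : Fin k → MixedModule R m n s}

theorem Reducible.exists_recursiveCall (hord : ord.IsWeighted) (h : Reducible ord f g) :
    ∃ S, RecursiveCall ord ⟨k, f, g⟩ S := by
  obtain ⟨c, hc⟩ := h.exists_selectedEcart hord
  rcases lt_or_ge (ord.ecart f) c with hlt | hle
  · obtain ⟨Q, R', hQ⟩ := exists_HDDwR (hord.upFinite_homogenized _)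
      (fun i => IsHom.lt (ord := ord.homogenized) (homogenization (g i)))
      ((isHom_homogenization f).X_pow_smul (c - ord.ecart f))
    exact ⟨_, .ecart f _ g Q ⟨h, c, _, hc, hlt, rfl, ⟨R', hQ⟩, rfl⟩⟩
  · obtain ⟨Q, R', hQ⟩ := exists_HDDwR (hord.upFinite_homogenized _)
      (fun i => ⟨_, isHom_homogenization (g i)⟩) (isHom_homogenization f)
    exact ⟨_, .direct f _ g Q ⟨h, c, hc, hle, R', hQ, rfl⟩⟩

/-- The bound on the monomials of the quotients of a homogeneous division survives the substitution
`x₀ = 1`. Only the leading monomials of the divisors matter, so it covers the division by the terms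
`lt(g_i^h)` as well as the division by the `g_i^h`. -/
theorem quotient_dehomogenization (hord : ord.IsWeighted) {D : ℕ} {F r : MixedModule R m (n + 1) s}
    (hF : IsHom D F) {G : Fin k → MixedModule R m (n + 1) s} (hG : ∀ i, ∃ d, IsHom d (G i))
    (hGg : ∀ i, ord.homogenized.lm (G i) = ord.homogenized.lm (homogenization (g i)))
    {Q : Fin k → MixedRing R m (n + 1)} (hQ : HDDwR ord.homogenized F G Q r) {i : Fin k}
    {b : Mon m n} (hb : ringCoeff (ringDehomogenization (Q i)) b ≠ 0) {a' : ModMon m n s}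
    (ha' : ord.lm (g i) = some a') :
    ∃ a, ord.lm (dehomogenization F) = some a ∧ ord.ge a (b + a'.1, a'.2) := by
  obtain ⟨B, hB1, hB2, hB⟩ := exists_of_ringCoeff_ringDehomogenization_ne_zero hb
  obtain ⟨A', hA', hdeg, A, hA, hge⟩ := hQ.quotient (hord.upFinite_homogenized D) hG hF hB
  rw [lm_homogenized_iff hF] at hA
  rw [hGg, lm_homogenization_iff] at hA'
  obtain rfl : a' = monDehomogenization A' := Option.some.inj (ha'.symm.trans hA'.2)
  refine ⟨_, hA.2, ?_⟩
  rw [ge_homogenized_iff (hA.1.trans hdeg.symm)] at hge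
  have : monDehomogenization (B + A'.1, A'.2) =
      (b + (monDehomogenization A').1, (monDehomogenization A').2) := by
    refine Prod.ext (Prod.ext ?_ ?_) rfl
    · simp [monDehomogenization, hB1]
    · ext j
      simp [monDehomogenization, ← hB2, Finsupp.tail_apply]
  rwa [this] at hge

theorem EcartStep.eq {Q : Fin k → MixedRing R m (n + 1)} {f' : MixedModule R m n s}
    (h : EcartStep ord f g Q f') : f' = f - ∑ i, ringDehomogenization (Q i) • g i := by
  obtain ⟨-, c, e, -, -, -, -, rfl⟩ := h
  rw [dehomogenization_sub, dehomogenization_sum_smul, dehomogenization_X_pow_smul,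
    dehomogenization_homogenization]
  simp only [dehomogenization_homogenization]

theorem EcartStep.quotient (hord : ord.IsWeighted) {Q : Fin k → MixedRing R m (n + 1)}
    {f' : MixedModule R m n s} (h : EcartStep ord f g Q f') {i : Fin k} {b : Mon m n}
    (hb : ringCoeff (ringDehomogenization (Q i)) b ≠ 0) {a' : ModMon m n s}
    (ha' : ord.lm (g i) = some a') : ∃ a, ord.lm f = some a ∧ ord.ge a (b + a'.1, a'.2) := by
  obtain ⟨-, c, e, -, -, -, ⟨R', hQ⟩, -⟩ := h
  have := quotient_dehomogenization hord ((isHom_homogenization f).X_pow_smul e)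
    (fun i => IsHom.lt _) (fun i => MonomialOrdering.lm_lt _) hQ hb ha'
  rwa [dehomogenization_X_pow_smul, dehomogenization_homogenization] at this

/-- The power of `x₀` in the step of positive `e` is chosen such that the leading term of
`x₀^e f^h` is reducible; it is therefore cancelled. -/
theorem EcartStep.gt_of_ne_zero (hord : ord.IsWeighted) {Q : Fin k → MixedRing R m (n + 1)}
    {f' : MixedModule R m n s} (h : EcartStep ord f g Q f') {b : ModMon m n s}
    (hb : modCoeff f' b ≠ 0) : ∃ a, ord.lm f = some a ∧ ord.gt a b := by
  obtain ⟨hred, c, e, hc, hlt, he, ⟨R', hQ⟩, rfl⟩ := h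
  obtain ⟨a, ha⟩ := hord.exists_lm hred.1
  refine ⟨a, ha, ?_⟩
  set F := (MvPolynomial.X 0 : MixedRing R m (n + 1)) ^ e • homogenization f with hFdef
  have hF : IsHom (degX f + e) F := (isHom_homogenization f).X_pow_smul e
  have hFf : dehomogenization F = f := by
    rw [hFdef, dehomogenization_X_pow_smul, dehomogenization_homogenization]
  have hup := hord.upFinite_homogenized (degX f + e)
  have hG : ∀ i, ∃ d, IsHom d (ord.homogenized.lt (homogenization (g i))) := fun i => IsHom.lt _
  have hlt_mem : ord.homogenized.lt F ∈ ord.homogenized.ltSpan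
      (fun i => ord.homogenized.lt (homogenization (g i))) Set.univ := by
    have := lt_mem_ltSpan_homogenized (g := g) hF (hFf.symm ▸ ha)
      (E := {i | ord.ecart (g i) ≤ c}) (fun i hi => by
        have := ecart_add_degree ha
        have hi' : ord.ecart (g i) ≤ c := hi
        omega) (by rw [hFf]; exact hc.lt_mem)
    simp only [MonomialOrdering.ltSpan, MonomialOrdering.lt_lt]
    exact MonomialOrdering.ltSpan_mono _ (Set.subset_univ _) this
  suffices H : ∀ B, modCoeff (F - ∑ i, Q i • homogenization (g i)) B ≠ 0 →
      B.1.2.degree = degX f + e ∧ ∃ A, ord.homogenized.lm F = some A ∧ ord.homogenized.gt A B by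
    obtain ⟨B, rfl, hB⟩ := exists_of_modCoeff_dehomogenization_ne_zero hb
    obtain ⟨hBD, A, hA, hgt⟩ := H B hB
    rw [lm_homogenized_iff hF, hFf] at hA
    obtain rfl : a = monDehomogenization A := Option.some.inj (ha.symm.trans hA.2)
    rcases hgt with hgt | hgt
    · omega
    · exact hgt.2
  intro B hB
  -- As `F = ∑ Q_i lt(g_i^h) + R'`, only `R'` and the tails of the `g_i^h` contribute to
  -- `F - ∑ Q_i g_i^h`.
  have hsplit : F - ∑ i, Q i • homogenization (g i) = R' - ∑ i, Q i •
      (homogenization (g i) - ord.homogenized.lt (homogenization (g i))) := by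
    have hsub : ∀ i, Q i • (homogenization (g i) - ord.homogenized.lt (homogenization (g i))) =
        Q i • homogenization (g i) - Q i • ord.homogenized.lt (homogenization (g i)) := fun i =>
      funext fun j => mul_sub (Q i) _ _
    rw [Finset.sum_congr rfl fun i _ => hsub i, Finset.sum_sub_distrib]
    conv_lhs => rw [hQ.eq hup hG hF]
    abel
  rw [hsplit, modCoeff_sub, modCoeff_sum] at hB
  by_cases hR : modCoeff R' B ≠ 0
  · obtain ⟨-, hBD, A, hA, hAB | hAB⟩ := hQ.remainder hup hG hF hR
    · exact absurd hlt_mem hAB.2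
    · exact ⟨hBD, A, hA, hAB⟩
  rw [not_not] at hR
  rw [hR, zero_sub] at hB
  obtain ⟨i, -, hi⟩ := Finset.exists_ne_zero_of_sum_ne_zero (neg_ne_zero.1 hB)
  obtain ⟨B₁, B₂, hsum, h1, h2⟩ := exists_of_modCoeff_smul_ne_zero hi
  obtain ⟨A', hA', hdeg, A, hA, hge⟩ := hQ.quotient hup hG hF h1
  rw [MonomialOrdering.lm_lt] at hA'
  have hne : (B₂, B.2) ≠ A' := by
    intro heq
    refine h2 ?_
    rw [heq, modCoeff_sub, MonomialOrdering.lt_of_lm hA', modCoeff_modTerm, if_pos rfl, sub_self]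
  rw [modCoeff_sub, MonomialOrdering.lt_of_lm hA', modCoeff_modTerm, if_neg hne, sub_zero] at h2
  have hgt := ((MonomialOrdering.lm_eq_some_iff.1 hA').2 _ h2).resolve_left hne.symm
  have hmul := ord.homogenized.mul_gt_mul _ _ B₁ hgt
  simp only [hsum] at hmul
  refine ⟨?_, A, hA, MonomialOrdering.gt_of_ge_of_gt hge hmul⟩
  have e1 := isHom_homogenization (g i) _ h2
  have e2 := (lm_homogenization_iff.1 hA').1
  rw [← hsum, ← hdeg]
  simp only [Prod.snd_add, map_add]
  rw [e2]
  exact congrArg _ e1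

theorem DirectStep.eq (hord : ord.IsWeighted) {Q : Fin k → MixedRing R m (n + 1)}
    {f' : MixedModule R m n s} (h : DirectStep ord f g Q f') :
    f' = f - ∑ i, ringDehomogenization (Q i) • g i := by
  obtain ⟨-, c, -, -, R', hQ, rfl⟩ := h
  have : R' = homogenization f - ∑ i, Q i • homogenization (g i) :=
    eq_sub_of_add_eq' (hQ.eq (hord.upFinite_homogenized _)
      (fun i => ⟨_, isHom_homogenization (g i)⟩) (isHom_homogenization f)).symm
  rw [this, dehomogenization_sub, dehomogenization_sum_smul, dehomogenization_homogenization]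
  simp only [dehomogenization_homogenization]

theorem DirectStep.quotient (hord : ord.IsWeighted) {Q : Fin k → MixedRing R m (n + 1)}
    {f' : MixedModule R m n s} (h : DirectStep ord f g Q f') {i : Fin k} {b : Mon m n}
    (hb : ringCoeff (ringDehomogenization (Q i)) b ≠ 0) {a' : ModMon m n s}
    (ha' : ord.lm (g i) = some a') : ∃ a, ord.lm f = some a ∧ ord.ge a (b + a'.1, a'.2) := by
  obtain ⟨-, c, -, -, R', hQ, -⟩ := h
  have := quotient_dehomogenization hord (isHom_homogenization f)
    (fun i => ⟨_, isHom_homogenization (g i)⟩) (fun i => rfl) hQ hb ha'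
  rwa [dehomogenization_homogenization] at this

/-- A term of the remainder `R'` is not in `⟨lt(g_i^h)⟩`; so the leading term of `R'^d` cannot be
reduced by elements whose ecart is at most that of `R'^d`. -/
theorem DirectStep.remainder (hord : ord.IsWeighted) {Q : Fin k → MixedRing R m (n + 1)}
    {f' : MixedModule R m n s} (h : DirectStep ord f g Q f') :
    (∀ b, modCoeff f' b ≠ 0 → ∃ a, ord.lm f = some a ∧ ord.ge a b) ∧
      (f' ≠ 0 → ord.lc f' ∉ ecartIdeal ord (Set.range g) f') := by
  obtain ⟨-, c, -, -, R', hQ, rfl⟩ := h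
  have hup := hord.upFinite_homogenized (degX f)
  have hG : ∀ i, ∃ d, IsHom d (homogenization (g i)) := fun i => ⟨_, isHom_homogenization (g i)⟩
  have hrem := fun B => hQ.remainder hup hG (isHom_homogenization f) (b := B)
  have hR' : IsHom (degX f) R' := fun B hB => (hrem B hB).2.1
  constructor
  · intro b hb
    obtain ⟨B, rfl, hB⟩ := exists_of_modCoeff_dehomogenization_ne_zero hb
    obtain ⟨-, hBD, A, hA, hAB⟩ := hrem B hB
    have hge : ord.homogenized.ge A B := hAB.imp And.left id
    rw [lm_homogenization_iff] at hA
    rw [ge_homogenized_iff (hA.1.trans hBD.symm)] at hge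
    exact ⟨_, hA.2, hge⟩
  · intro h0 hmem
    obtain ⟨a, ha⟩ := hord.exists_lm h0
    rw [← lt_mem_ltSpan_ecart_iff ha] at hmem
    have hlt := lt_mem_ltSpan_homogenized hR' ha (fun i hi => by
      have h1 := ecart_add_degree ha
      have h2 := degX_dehomogenization_le hR'
      have h3 := hi.2
      omega) hmem
    have hne : R' ≠ 0 := by
      rintro rfl
      exact h0 (funext fun _ => map_zero _)
    obtain ⟨A, hA⟩ := MonomialOrdering.exists_lm hup hR' hne
    rw [MonomialOrdering.lt_of_lm hA] at hlt
    exact (hrem A (MonomialOrdering.lm_eq_some_iff.1 hA).1).1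
      (MonomialOrdering.ltSpan_mono _ (Set.subset_univ _) hlt)

theorem DirectStep.lc_mem (hord : ord.IsWeighted) {Q : Fin k → MixedRing R m (n + 1)}
    {f' : MixedModule R m n s} (h : DirectStep ord f g Q f') :
    ord.lc f ∈ ecartIdeal ord (Set.range g) f := by
  obtain ⟨hred, c, hc, hle, -⟩ := h
  obtain ⟨a, ha⟩ := hord.exists_lm hred.1
  have hmem := hc.lt_mem
  rw [← lt_mem_ltSpan_ecart_iff ha, lt_mem_ltSpan_iff ha]
  rw [lt_mem_ltSpan_iff ha, lcIdeal_eq ha] at hmem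
  rw [lcIdeal_eq ha]
  refine Ideal.span_mono (Set.image_mono ?_) hmem
  rintro i ⟨hi, hi'⟩
  exact ⟨⟨hi', le_trans hi hle⟩, hi'⟩

end Steps

/-! ### Termination -/

section Termination

/-- The ascending chain condition for modules generated by terms: a combination of Dickson's lemma
and the ascending chain condition in `R`. -/
theorem exists_mem_span_of_wellQuasiOrdered {R P : Type*} [CommRing R] [IsNoetherianRing R]
    [Preorder P] [WellQuasiOrderedLE P] (a : ℕ → P) (c : ℕ → R) :
    ∃ ν, c ν ∈ Ideal.span (c '' {μ | μ < ν ∧ a μ ≤ a ν}) := by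
  obtain ⟨φ, hφ⟩ := (wellQuasiOrdered_le (α := P)).exists_monotone_subseq a
  let I : ℕ →o Ideal R := ⟨fun j => Ideal.span ((fun i => c (φ i)) '' {i | i < j}),
    fun j j' h => Ideal.span_mono (Set.image_mono fun i hi => lt_of_lt_of_le hi h)⟩
  obtain ⟨j, hj⟩ := monotone_stabilizes_iff_noetherian.2 ‹IsNoetherianRing R› I
  refine ⟨φ j, ?_⟩
  have hmem : c (φ j) ∈ I (j + 1) := Ideal.subset_span ⟨j, Nat.lt_succ_self j, rfl⟩
  rw [← hj (j + 1) (Nat.le_succ j)] at hmem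
  refine Ideal.span_mono ?_ hmem
  rintro _ ⟨i, hi, rfl⟩
  exact ⟨φ i, ⟨φ.strictMono hi, hφ _ _ (le_of_lt hi)⟩, rfl⟩

variable {R : Type*} [CommRing R] {m n s : ℕ} {ord : MonomialOrdering m n s}

theorem range_snoc {α : Type*} {k : ℕ} (g : Fin k → α) (x : α) :
    Set.range (Fin.snoc g x : Fin (k + 1) → α) = insert x (Set.range g) := by
  ext y
  constructor
  · rintro ⟨i, rfl⟩
    refine Fin.lastCases ?_ (fun i => ?_) i
    · simp
    · simp
  · rintro (rfl | ⟨i, rfl⟩)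
    · exact ⟨Fin.last k, by simp⟩
    · exact ⟨i.castSucc, by simp⟩

/-- Either the element `f` of the input joins the list and its leading term could not have been
reduced with ecarts at most `ecart f`, or the list is kept and the new element has this property
(or vanishes). -/
theorem RecursiveCall.cases_lc (hord : ord.IsWeighted) {S S' : Input R m n s}
    (h : RecursiveCall ord S S') : S.f ≠ 0 ∧
      (ord.lc S.f ∉ ecartIdeal ord (Set.range S.g) S.f ∧
          Set.range S'.g = insert S.f (Set.range S.g) ∨
        ord.lc S.f ∈ ecartIdeal ord (Set.range S.g) S.f ∧ Set.range S'.g = Set.range S.g ∧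
          (S'.f ≠ 0 → ord.lc S'.f ∉ ecartIdeal ord (Set.range S'.g) S'.f)) := by
  rcases h with ⟨f, f', g, Q, hstep⟩ | ⟨f, f', g, Q, hstep⟩
  · refine ⟨hstep.1.1, Or.inl ⟨?_, range_snoc g f⟩⟩
    obtain ⟨hred, c, e, hc, hlt, -⟩ := hstep
    exact hc.lc_notMem hord hred hlt
  · exact ⟨hstep.1.1, Or.inr ⟨hstep.lc_mem hord, rfl, (hstep.remainder hord).2⟩⟩

theorem not_exists_infinite_recursion [IsNoetherianRing R] (hord : ord.IsWeighted) :
    ¬ ∃ S : ℕ → Input R m n s, ∀ ν, RecursiveCall ord (S ν) (S (ν + 1)) := by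
  rintro ⟨S, hS⟩
  have hspec := fun ν => (hS ν).cases_lc hord
  have hfreq : ∀ N, ∃ ν > N, ord.lc (S ν).f ∉ ecartIdeal ord (Set.range (S ν).g) (S ν).f := by
    intro N
    rcases (hspec (N + 1)).2 with h | h
    · exact ⟨N + 1, by omega, h.1⟩
    · exact ⟨N + 2, by omega, h.2.2 (hspec (N + 2)).1⟩
  obtain ⟨φ, hφ, hφT⟩ := Nat.exists_strictMono_subsequence hfreq
  have hmono : Monotone fun ν => Set.range (S ν).g := by
    refine monotone_nat_of_le_succ fun ν => ?_
    rcases (hspec ν).2 with h | h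
    · rw [h.2]
      exact Set.subset_insert _ _
    · rw [h.2.1]
  choose a ha using fun ν => hord.exists_lm (hspec ν).1
  -- Comparability of `i` and of its copy with the opposite order forces equality.
  let A : ℕ → Mon m n × ℕ × Fin s × (Fin s)ᵒᵈ := fun j =>
    ((a (φ j)).1, ord.ecart (S (φ j)).f, (a (φ j)).2, OrderDual.toDual (a (φ j)).2)
  obtain ⟨j, hj⟩ := exists_mem_span_of_wellQuasiOrdered A fun j => ord.lc (S (φ j)).f
  refine hφT j (Ideal.span_mono ?_ hj)
  rintro _ ⟨i, ⟨hij, h1, h2, h3, h4⟩, rfl⟩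
  refine ⟨(S (φ i)).f, ⟨?_, ?_, h2⟩, rfl⟩
  · have hmem : (S (φ i)).f ∈ Set.range (S (φ i + 1)).g := by
      rcases (hspec (φ i)).2 with h | h
      · rw [h.2]
        exact Set.mem_insert _ _
      · exact absurd h.1 (hφT i)
    exact hmono (Nat.succ_le_of_lt (hφ hij)) hmem
  · exact (lmDvd_iff (ha (φ j))).2 ⟨_, ha (φ i), le_antisymm h3 h4, h1⟩

theorem exists_DwR [IsNoetherianRing R] (hord : ord.IsWeighted) {k : ℕ} (f : MixedModule R m n s)
    (g : Fin k → MixedModule R m n s) : ∃ u q r, DwR ord f g u q r := by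
  suffices H : ∀ S : Input R m n s, ∃ u q r, DwR ord S.f S.g u q r from H ⟨k, f, g⟩
  intro S
  have hwf : WellFounded fun S S' : Input R m n s => RecursiveCall ord S' S := by
    rw [wellFounded_iff_isEmpty_descending_chain]
    exact ⟨fun ⟨T, hT⟩ => not_exists_infinite_recursion hord ⟨T, hT⟩⟩
  induction S using hwf.induction with
  | h S ih =>
    obtain ⟨k, f, g⟩ := S
    by_cases hred : Reducible ord f g
    · obtain ⟨S', hS'⟩ := hred.exists_recursiveCall hord
      obtain ⟨u, q, r, hrec⟩ := ih S' hS'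
      rcases hS' with ⟨_, f', _, Q, hstep⟩ | ⟨_, f', _, Q, hstep⟩
      · exact ⟨_, _, r, .ecart f f' r g Q u q hstep hrec⟩
      · exact ⟨_, _, r, .direct f f' r g Q u q hstep hrec⟩
    · exact ⟨1, 0, f, .done f g hred⟩

end Termination

/-! ### Correctness -/

section Correctness

variable {R : Type*} [CommRing R] {m n s k : ℕ} {ord : MonomialOrdering m n s}

/-- A weak division in which (ID1) holds in a strong form: the product of each monomial of `q_i`
with `lm(g_i)` is at most `lm(f)`. Because `R` may have zero divisors, this is not implied by
`lm(f) ≥ lm(q_i g_i)`. -/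
structure IsStrongDivision (ord : MonomialOrdering m n s) (f : MixedModule R m n s)
    (g : Fin k → MixedModule R m n s) (u : MixedRing R m n) (q : Fin k → MixedRing R m n)
    (r : MixedModule R m n s) : Prop where
  coeff_one : ringCoeff u 0 = 1
  le_one : ∀ b, ringCoeff u b ≠ 0 → b = 0 ∨ ord.ringGt 0 b
  eq : u • f = ∑ i, q i • g i + r
  quotient : ∀ i b, ringCoeff (q i) b ≠ 0 → ∀ a', ord.lm (g i) = some a' →
    ∃ a, ord.lm f = some a ∧ ord.ge a (b + a'.1, a'.2)
  id2 : r ≠ 0 → ord.lt r ∉ ord.ltSpan g Set.univ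

theorem ringLt_eq_one {u : MixedRing R m n} (h1 : ringCoeff u 0 = 1)
    (hle : ∀ b, ringCoeff u b ≠ 0 → b = 0 ∨ ord.ringGt 0 b) : ord.ringLt u = 1 := by
  rcases subsingleton_or_nontrivial R with hR | hR
  · exact ringExt fun a => Subsingleton.elim _ _
  · have : greatest ord.ringGt {a | ringCoeff u a ≠ 0} = some 0 := by
      rw [greatest_eq_some_iff fun _ _ => MonomialOrdering.ringGt_asymm]
      refine ⟨?_, fun b hb hne => (hle b hb).resolve_left hne⟩
      rw [Set.mem_ofPred_eq, h1]
      exact one_ne_zero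
    rw [MonomialOrdering.ringLt, this]
    simp only [h1, ringTerm_zero_one]

theorem IsStrongDivision.isWeakDivision (hord : ord.IsWeighted) {f : MixedModule R m n s}
    {g : Fin k → MixedModule R m n s} {u : MixedRing R m n} {q : Fin k → MixedRing R m n}
    {r : MixedModule R m n s} (h : IsStrongDivision ord f g u q r) :
    IsWeakDivision ord f g u q r where
  lt_unit := ringLt_eq_one h.coeff_one h.le_one
  eq := h.eq
  id1 := by
    intro i b hb
    obtain ⟨b₁, b₂, hsum, h1, h2⟩ :=
      exists_of_modCoeff_smul_ne_zero (MonomialOrdering.lm_eq_some_iff.1 hb).1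
    have hg : g i ≠ 0 := by
      intro h0
      simp [h0] at h2
    obtain ⟨a', ha'⟩ := hord.exists_lm hg
    obtain ⟨a, ha, hge⟩ := h.quotient i b₁ h1 a' ha'
    refine ⟨a, ha, MonomialOrdering.ge_trans hge ?_⟩
    have := MonomialOrdering.ge_mul b₁ ((MonomialOrdering.lm_eq_some_iff.1 ha').2 _ h2)
    simpa only [hsum] using this
  id2 := h.id2

/-- The bound on the monomials of `q` is stable under adding `u p` if no monomial of `u` is
greater than `1` and `p` obeys the bound. -/
theorem quotient_add_mul {u q p : MixedRing R m n} {a a' : ModMon m n s}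
    (hu : ∀ b, ringCoeff u b ≠ 0 → b = 0 ∨ ord.ringGt 0 b)
    (hq : ∀ b, ringCoeff q b ≠ 0 → ord.ge a (b + a'.1, a'.2))
    (hp : ∀ b, ringCoeff p b ≠ 0 → ord.ge a (b + a'.1, a'.2)) {b : Mon m n}
    (hb : ringCoeff (q + u * p) b ≠ 0) : ord.ge a (b + a'.1, a'.2) := by
  by_cases h : ringCoeff q b ≠ 0
  · exact hq b h
  rw [not_not] at h
  rw [ringCoeff_add, h, zero_add] at hb
  obtain ⟨b₁, b₂, rfl, h1, h2⟩ := exists_of_ringCoeff_mul_ne_zero hb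
  refine MonomialOrdering.ge_trans (hp b₂ h2) ?_
  rw [add_assoc]
  exact MonomialOrdering.ge_add_of_ringGt (hu b₁ h1) (b₂ + a'.1, a'.2)

theorem DwR.isStrongDivision (hord : ord.IsWeighted) {f : MixedModule R m n s}
    {g : Fin k → MixedModule R m n s} {u : MixedRing R m n} {q : Fin k → MixedRing R m n}
    {r : MixedModule R m n s} (h : DwR ord f g u q r) : IsStrongDivision ord f g u q r := by
  induction h with
  | done f g h =>
    refine ⟨by rw [ringCoeff_one, if_pos rfl], fun b hb => ?_, by simp, fun i b hb => ?_,
      fun h0 hmem => h ⟨h0, hmem⟩⟩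
    · rw [ringCoeff_one] at hb
      exact Or.inl (of_not_not fun h => hb (if_neg h))
    · simp at hb
  | ecart f f' r g Q u q hstep hrec ih =>
    obtain ⟨a, ha⟩ := hord.exists_lm hstep.1.1
    have hf' : ∀ a', ord.lm f' = some a' → ord.gt a a' := by
      intro a' ha'
      obtain ⟨a₂, ha₂, hgt⟩ :=
        hstep.gt_of_ne_zero hord (MonomialOrdering.lm_eq_some_iff.1 ha').1
      rwa [Option.some.inj (ha.symm.trans ha₂)]
    -- All monomials of the quotient of `f` are smaller than `1`.
    have hlast : ∀ b, ringCoeff (q (Fin.last _)) b ≠ 0 → ord.ringGt 0 b := by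
      intro b hb
      obtain ⟨a', ha', hge⟩ := ih.quotient _ b hb a (by rwa [Fin.snoc_last])
      exact MonomialOrdering.ringGt_zero_of_gt
        (MonomialOrdering.gt_of_gt_of_ge (hf' a' ha') hge)
    refine ⟨?_, fun b hb => ?_, ?_, fun i b hb a' ha' => ⟨a, ha, ?_⟩, fun h0 hmem =>
      ih.id2 h0 (Submodule.span_mono ?_ hmem)⟩
    · have : ringCoeff (q (Fin.last _)) 0 = 0 := by
        by_contra hne
        exact MonomialOrdering.ringGt_asymm (hlast 0 hne) (hlast 0 hne)
      rw [ringCoeff_sub, ih.coeff_one, this, sub_zero]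
    · by_cases hu : ringCoeff u b ≠ 0
      · exact ih.le_one b hu
      · rw [not_not] at hu
        rw [ringCoeff_sub, hu, zero_sub] at hb
        exact Or.inr (hlast b (neg_ne_zero.1 hb))
    · have := ih.eq
      rw [Fin.sum_univ_castSucc, hstep.eq] at this
      simp only [Fin.snoc_castSucc, Fin.snoc_last] at this
      funext j
      have hj := congrFun this j
      simp only [Pi.smul_apply, Pi.add_apply, Pi.sub_apply, Finset.sum_apply, smul_eq_mul, add_mul,
        Finset.sum_add_distrib, mul_sub, Finset.mul_sum, sub_mul, mul_assoc] at hj ⊢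
      linear_combination hj
    · refine quotient_add_mul ih.le_one (fun c hc => ?_) (fun c hc => ?_) hb
      · obtain ⟨a₂, ha₂, hge⟩ := ih.quotient i.castSucc c hc a' (by rwa [Fin.snoc_castSucc])
        exact Or.inr (MonomialOrdering.gt_of_gt_of_ge (hf' a₂ ha₂) hge)
      · obtain ⟨a₂, ha₂, hge⟩ := hstep.quotient hord hc ha'
        rwa [Option.some.inj (ha.symm.trans ha₂)]
    · rintro _ ⟨i, -, rfl⟩
      exact ⟨i.castSucc, trivial, by simp⟩
  | direct f f' r g Q u q hstep hrec ih =>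
    obtain ⟨a, ha⟩ := hord.exists_lm hstep.1.1
    refine ⟨ih.coeff_one, ih.le_one, ?_, fun i b hb a' ha' => ⟨a, ha, ?_⟩, ih.id2⟩
    · have := ih.eq
      rw [hstep.eq hord] at this
      funext j
      have hj := congrFun this j
      simp only [Pi.smul_apply, Pi.add_apply, Pi.sub_apply, Finset.sum_apply, smul_eq_mul, add_mul,
        Finset.sum_add_distrib, mul_sub, Finset.mul_sum, mul_assoc] at hj ⊢
      linear_combination hj
    · refine quotient_add_mul ih.le_one (fun c hc => ?_) (fun c hc => ?_) hb
      · obtain ⟨a₂, ha₂, hge⟩ := ih.quotient i c hc a' ha'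
        obtain ⟨a₃, ha₃, hge'⟩ :=
          (hstep.remainder hord).1 a₂ (MonomialOrdering.lm_eq_some_iff.1 ha₂).1
        rw [Option.some.inj (ha.symm.trans ha₃)]
        exact MonomialOrdering.ge_trans hge' hge
      · obtain ⟨a₂, ha₂, hge⟩ := hstep.quotient hord hc ha'
        rwa [Option.some.inj (ha.symm.trans ha₂)]

end Correctness

end MixedDivision

end

theorem mainTheorem1 {R : Type*} [CommRing R] [IsNoetherianRing R] {m n s k : ℕ}
    (ord : MixedDivision.MonomialOrdering m n s) (hord : ord.IsWeighted)
    (f : MixedDivision.MixedModule R m n s) (g : Fin k → MixedDivision.MixedModule R m n s) :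
    -- there is no infinite chain of recursive calls
    (¬ ∃ S : ℕ → MixedDivision.Input R m n s,
        S 0 = ⟨k, f, g⟩ ∧ ∀ ν, MixedDivision.RecursiveCall ord (S ν) (S (ν + 1))) ∧
    -- the procedure never gets stuck: at each input reached, it stops or makes a recursive call
    (∀ S : MixedDivision.Input R m n s,
        Relation.ReflTransGen (MixedDivision.RecursiveCall ord) ⟨k, f, g⟩ S →
        MixedDivision.Reducible ord S.f S.g →
        ∃ S', MixedDivision.RecursiveCall ord S S') ∧
    -- the procedure has an output, and each output is a weak division with remainder
    (∃ u q r, MixedDivision.DwR ord f g u q r) ∧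
    (∀ u q r, MixedDivision.DwR ord f g u q r → MixedDivision.IsWeakDivision ord f g u q r) := by
  exact ⟨fun ⟨S, _, hS⟩ => MixedDivision.not_exists_infinite_recursion hord ⟨S, hS⟩,
    fun _ _ hred => hred.exists_recursiveCall hord, MixedDivision.exists_DwR hord f g,
    fun _ _ _ h => (h.isStrongDivision hord).isWeakDivision hord⟩
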